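/- Let $\alpha=(\alpha_1,\alpha_2)$ with $\alpha_1,\alpha_2>0$ and $\alpha_1+\alpha_2=2$, let $s\in\mathbb R$ and $f\in\mathcal S'(\mathbb R^2)$ (complex valued). **Sobolev space.** For $t>0$ put $t^\alpha\xi=(t^{\alpha_1}\xi_1,t^{\alpha_2}\xi_2)$. Let $\varphi_0^\alpha\in\mathcal S(\mathbb R^2)$, $\varphi_0^\alpha\ge 0$, with $\varphi_0^\alpha(\xi)=1$ if $\sup_i|\xi_i|\le1$ and $\varphi_0^\alpha(\xi)=0$ if $\sup_i 2^{-\alpha_i}|\xi_i|\ge1$; for $j\ge1$ let $\varphi_j^\alpha(\xi)=\varphi_0^\alpha(2^{-j\alpha}\xi)-\varphi_0^\alpha(2^{-(j-1)\alpha}\xi)$, and let $\Delta_j^\alpha f=\mathcal F^{-1}(\varphi_j^\alpha\widehat f)$ for $j\ge0$, where $\widehat f(\xi)=\int f(x)e^{-ix\cdot\xi}\,dx$. Then $H^{s,\alpha}(\mathbb R^2)=B^{s,\alpha}_{2,2}(\mathbb R^2)$ is the set of $f\in\mathcal S'(\mathbb R^2)$ with $\big(\sum_{j\ge0}2^{2js}\|\Delta_j^\alpha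 f\|_{L^2}^2\big)^{1/2}<\infty$, where $\|\cdot\|_{L^2}=\infty$ for a distribution that is not in $L^2$. **Wavelet coefficients.** Let $\nu\in C^\infty(\mathbb R)$ be real valued with $\nu=0$ on $(-\infty,0]$, $\nu=1$ on $[1,\infty)$ and $\nu(x)+\nu(1-x)=1$ for all $x$. Let $\varphi,\psi\in\mathcal S(\mathbb R)$ be the associated Meyer scaling function and Meyer wavelet, that is $\widehat\varphi(\xi)=\cos\big(\tfrac\pi2\nu(\tfrac{3}{2\pi}|\xi|-1)\big)$ and $\widehat\psi(\xi)=e^{i\xi/2}\sin\big(\tfrac\pi2\nu(\tfrac3{2\pi}|\xi|-1)\big)\cos\big(\tfrac\pi2\nu(\tfrac3{4\pi}|\xi|-1)\big)$. For $j,k\in\mathbb Z$, $j\ge-1$, put $\psi_{j,k}(x)=\psi(2^jx-k)$ if $j\ge0$ and $\psi_{-1,k}(x)=\varphi(x-k)$. For $j_1,j_2\ge-1$ and $k_1,k_2\in\mathbb Z$ let $$c_{j_1,j_2,k_1,k_2}=2^{\max(j_1,0)+\max(j_2,0)}\langle f,\psi_{j_1,k_1}\otimes\psi_{j_2,k_2}\rangle,\qquad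 \|c_{j_1,j_2,\cdot,\cdot}\|_{\ell^2}=\Big(\sum_{(k_1,k_2)\in\mathbb Z^2}|c_{j_1,j_2,k_1,k_2}|^2\Big)^{1/2}\in[0,\infty].$$ **Index sets.** With $[\cdot]$ the integer part (floor), for $j\in\mathbb N_0$ and $i=1,2$ let $$H_j^i=\{l\in\mathbb Z:\ l\ge-1,\ [(j-1)\alpha_i]-1\le l\le[j\alpha_i]+1\},\qquad L_j^i=\{l\in\mathbb Z:\ -1\le l\le[(j-1)\alpha_i]-1\},$$ and $\Gamma_j(\alpha)=(H_j^1\times L_j^2)\cup(L_j^1\times H_j^2)\cup(H_j^1\times H_j^2)$. **Theorem.** For every such $\alpha$, $s$, $f$, $\varphi_0^\alpha$ and $\nu$, the following are equivalent: (i) $f\in H^{s,\alpha}(\mathbb R^2)=B^{s,\alpha}_{2,2}(\mathbb R^2)$; (ii) $\displaystyle\Big(\sum_{j\in\mathbb N_0}2^{2js}\sum_{(j_1,j_2)\in\Gamma_j(\alpha)}2^{-(j_1+j_2)}\,\|c_{j_1,j_2,\cdot,\cdot}\|_{\ell^2}^2\Big)^{1/2}<\infty.$ -/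

import Mathlib

open MeasureTheory FourierTransform
open scoped SchwartzMap ENNReal ContDiff

noncomputable section

namespace HyperbolicWavelet

/-- The plane `ℝ²` with its Euclidean structure. -/
abbrev Plane : Type := EuclideanSpace ℝ (Fin 2)

/-! ### Anisotropies and anisotropic Littlewood-Paley analysis -/

/-- Admissible anisotropies: positive exponents of sum `2`. -/
structure IsAdmissible (α : Fin 2 → ℝ) : Prop where
  pos : ∀ i, 0 < α i
  sum_eq : α 0 + α 1 = 2

/-- The anisotropic scaling `t ^ α ξ = (t ^ α₁ ξ₁, t ^ α₂ ξ₂)`. -/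
def anisoScale (α : Fin 2 → ℝ) (t : ℝ) (ξ : Plane) : Plane :=
  WithLp.toLp 2 fun i => t ^ α i * ξ i

/-- The requirements on the first function of an anisotropic resolution of the unity:
it is nonnegative, it is `1` where `sup |ξᵢ| ≤ 1` and `0` where `sup 2 ^ (-αᵢ) |ξᵢ| ≥ 1`. -/
structure IsAnisoCutoff (α : Fin 2 → ℝ) (φ₀ : 𝓢(Plane, ℝ)) : Prop where
  nonneg : ∀ ξ, 0 ≤ φ₀ ξ
  eq_one : ∀ ξ : Plane, (∀ i, |ξ i| ≤ 1) → φ₀ ξ = 1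
  eq_zero : ∀ ξ : Plane, (∃ i, 1 ≤ (2 : ℝ) ^ (-α i) * |ξ i|) → φ₀ ξ = 0

/-- The anisotropic resolution of the unity `(φⱼ)` generated by `φ₀`, namely
`φⱼ(ξ) = φ₀(2 ^ (-j α) ξ) - φ₀(2 ^ (-(j-1) α) ξ)` for `j ≥ 1`. -/
def anisoResolution (α : Fin 2 → ℝ) (φ₀ : 𝓢(Plane, ℝ)) : ℕ → Plane → ℝ
  | 0 => fun ξ => φ₀ ξ
  | j + 1 => fun ξ =>
      φ₀ (anisoScale α ((2 : ℝ) ^ (-((j : ℝ) + 1))) ξ) - φ₀ (anisoScale α ((2 : ℝ) ^ (-(j : ℝ))) ξ)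

/-- The anisotropic Littlewood-Paley block `Δⱼ f = 𝓕⁻¹ (φⱼ f̂)`. The Fourier transform is the one
with kernel `exp (-i x · ξ)`; Mathlib's has kernel `exp (-2 π i x · η)`, so `ξ = 2 π η`. -/
def anisoBlock (α : Fin 2 → ℝ) (φ₀ : 𝓢(Plane, ℝ)) (j : ℕ) (f : 𝓢'(Plane, ℂ)) : 𝓢'(Plane, ℂ) :=
  TemperedDistribution.fourierMultiplierCLM ℂ
    (fun η : Plane => ((anisoResolution α φ₀ j ((2 * Real.pi) • η) : ℝ) : ℂ)) f

/-- The `L²` norm of a tempered distribution: the norm of the square integrable function that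
represents it, and `∞` if there is none. -/
def distL2Norm (T : 𝓢'(Plane, ℂ)) : ℝ≥0∞ :=
  ⨅ (g : Lp ℂ 2 (volume : Measure Plane)) (_ : Lp.toTemperedDistribution g = T), ‖g‖ₑ

/-- The norm of `B^{s,α}_{2,2}(ℝ²)`, with values in `[0, ∞]`. -/
def anisoSobolevNorm (α : Fin 2 → ℝ) (φ₀ : 𝓢(Plane, ℝ)) (s : ℝ) (f : 𝓢'(Plane, ℂ)) : ℝ≥0∞ :=
  (∑' j : ℕ, ENNReal.ofReal ((2 : ℝ) ^ (2 * j * s)) *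
    distL2Norm (anisoBlock α φ₀ j f) ^ 2) ^ (1 / 2 : ℝ)

/-- The anisotropic Sobolev space `H^{s,α}(ℝ²) = B^{s,α}_{2,2}(ℝ²)`, defined through the
anisotropic resolution of the unity generated by `φ₀`. -/
def anisoSobolev (α : Fin 2 → ℝ) (φ₀ : 𝓢(Plane, ℝ)) (s : ℝ) : Set 𝓢'(Plane, ℂ) :=
  {f | anisoSobolevNorm α φ₀ s f < ⊤}

/-! ### The Meyer wavelet -/

/-- A smooth transition function from `0` to `1`, as used to build the Meyer wavelet. -/
structure MeyerProfile where
  ν : ℝ → ℝ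
  smooth : ContDiff ℝ ∞ ν
  eq_zero : ∀ x, x ≤ 0 → ν x = 0
  eq_one : ∀ x, 1 ≤ x → ν x = 1
  add_eq_one : ∀ x, ν x + ν (1 - x) = 1

namespace MeyerProfile

variable (m : MeyerProfile)

/-- The Fourier transform `∫ φ(x) exp (-i x ξ) dx` of the Meyer scaling function: it is `1` for
`|ξ| ≤ 2π/3`, `cos (π/2 ν(3|ξ|/(2π) - 1))` for `2π/3 ≤ |ξ| ≤ 4π/3` and `0` for `|ξ| ≥ 4π/3`. -/
def scalingHat (ξ : ℝ) : ℂ :=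
  ((Real.cos (Real.pi / 2 * m.ν (3 / (2 * Real.pi) * |ξ| - 1)) : ℝ) : ℂ)

/-- The Fourier transform `∫ ψ(x) exp (-i x ξ) dx` of the Meyer wavelet: it is
`exp (i ξ/2) sin (π/2 ν(3|ξ|/(2π) - 1))` for `2π/3 ≤ |ξ| ≤ 4π/3`,
`exp (i ξ/2) cos (π/2 ν(3|ξ|/(4π) - 1))` for `4π/3 ≤ |ξ| ≤ 8π/3` and `0` elsewhere
(in each of these regions one of the two real factors below is constant). -/
def waveletHat (ξ : ℝ) : ℂ :=
  Complex.exp (Complex.I * ((ξ / 2 : ℝ) : ℂ)) *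
    (((Real.sin (Real.pi / 2 * m.ν (3 / (2 * Real.pi) * |ξ| - 1)) *
      Real.cos (Real.pi / 2 * m.ν (3 / (4 * Real.pi) * |ξ| - 1)) : ℝ)) : ℂ)

theorem contDiff_ramp (a : ℝ) : ContDiff ℝ ∞ fun ξ : ℝ => m.ν (a * |ξ| - 1) := by
  rw [contDiff_iff_contDiffAt]
  intro ξ
  by_cases h : ξ = 0
  · have h0 : (fun ξ : ℝ => m.ν (a * |ξ| - 1)) =ᶠ[nhds ξ] fun _ => (0 : ℝ) := by
      have hc : ContinuousAt (fun ξ : ℝ => a * |ξ| - 1) ξ := by fun_prop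
      have h1 : a * |ξ| - 1 < 0 := by simp [h]
      filter_upwards [hc.eventually (gt_mem_nhds h1)] with x hx
      exact m.eq_zero _ hx.le
    exact contDiffAt_const.congr_of_eventuallyEq h0
  · have h1 : ContDiffAt ℝ ∞ (fun ξ : ℝ => a * |ξ| - 1) ξ :=
      (contDiffAt_const.mul (contDiffAt_abs h)).sub contDiffAt_const
    exact m.smooth.contDiffAt.comp ξ h1

theorem contDiff_scalingHat : ContDiff ℝ ∞ m.scalingHat :=
  Complex.ofRealCLM.contDiff.comp
    (Real.contDiff_cos.comp (contDiff_const.mul (m.contDiff_ramp _)))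

theorem contDiff_waveletHat : ContDiff ℝ ∞ m.waveletHat := by
  refine ContDiff.mul ?_ (Complex.ofRealCLM.contDiff.comp (ContDiff.mul ?_ ?_))
  · exact (contDiff_const.mul (Complex.ofRealCLM.contDiff.comp (contDiff_id.div_const 2))).cexp
  · exact Real.contDiff_sin.comp (contDiff_const.mul (m.contDiff_ramp _))
  · exact Real.contDiff_cos.comp (contDiff_const.mul (m.contDiff_ramp _))

theorem scalingHat_eq_zero {ξ : ℝ} (h : 4 * Real.pi / 3 ≤ |ξ|) : m.scalingHat ξ = 0 := by
  have h1 : 1 ≤ 3 / (2 * Real.pi) * |ξ| - 1 := by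
    have := mul_le_mul_of_nonneg_left h (show 0 ≤ 3 / (2 * Real.pi) by positivity)
    have h2 : 3 / (2 * Real.pi) * (4 * Real.pi / 3) = 2 := by field_simp; norm_num
    linarith
  simp [scalingHat, m.eq_one _ h1]

theorem waveletHat_eq_zero {ξ : ℝ} (h : 8 * Real.pi / 3 ≤ |ξ|) : m.waveletHat ξ = 0 := by
  have h1 : 1 ≤ 3 / (4 * Real.pi) * |ξ| - 1 := by
    have := mul_le_mul_of_nonneg_left h (show 0 ≤ 3 / (4 * Real.pi) by positivity)
    have h2 : 3 / (4 * Real.pi) * (8 * Real.pi / 3) = 2 := by field_simp; norm_num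
    linarith
  simp [waveletHat, m.eq_one _ h1]

theorem hasCompactSupport_rescale {g : ℝ → ℂ} {R : ℝ} (hg : ∀ ξ, R ≤ |ξ| → g ξ = 0) :
    HasCompactSupport fun η : ℝ => g (2 * Real.pi * η) := by
  refine HasCompactSupport.intro (isCompact_Icc (a := -|R|) (b := |R|)) fun η hη => hg _ ?_
  have h1 : |R| < |η| := by
    by_contra hc
    exact hη (abs_le.mp (not_lt.mp hc))
  have h2 : |2 * Real.pi * η| = 2 * Real.pi * |η| := by
    rw [abs_mul, abs_of_pos (by positivity)]
  rw [h2]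
  have h3 : 1 ≤ 2 * Real.pi := by linarith [Real.pi_gt_three]
  have h4 := mul_le_mul_of_nonneg_right h3 (abs_nonneg η)
  linarith [le_abs_self R]

/-- The Meyer scaling function `φ(x) = (2π)⁻¹ ∫ φ̂(ξ) exp (i x ξ) dξ = ∫ φ̂(2πη) exp (2πi x η) dη`. -/
def scaling : 𝓢(ℝ, ℂ) :=
  𝓕⁻ (HasCompactSupport.toSchwartzMap
    (hasCompactSupport_rescale fun _ h => m.scalingHat_eq_zero h)
    (m.contDiff_scalingHat.comp (contDiff_const.mul contDiff_id)))

/-- The Meyer wavelet `ψ(x) = (2π)⁻¹ ∫ ψ̂(ξ) exp (i x ξ) dξ = ∫ ψ̂(2πη) exp (2πi x η) dη`. -/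
def wavelet : 𝓢(ℝ, ℂ) :=
  𝓕⁻ (HasCompactSupport.toSchwartzMap
    (hasCompactSupport_rescale fun _ h => m.waveletHat_eq_zero h)
    (m.contDiff_waveletHat.comp (contDiff_const.mul contDiff_id)))

end MeyerProfile

/-! ### Hyperbolic wavelets -/

/-- The function `x ↦ g(2 ^ j x - k)`. -/
def dilateTranslate (g : 𝓢(ℝ, ℂ)) (j k : ℤ) : 𝓢(ℝ, ℂ) :=
  SchwartzMap.compCLMOfContinuousLinearEquiv ℂ
    (ContinuousLinearEquiv.unitsEquivAut ℝ (Units.mk0 ((2 : ℝ) ^ j) (by positivity)))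
    (SchwartzMap.compSubConstCLM ℂ (k : ℝ) g)

theorem dilateTranslate_apply (g : 𝓢(ℝ, ℂ)) (j k : ℤ) (x : ℝ) :
    dilateTranslate g j k x = g ((2 : ℝ) ^ j * x - k) := by
  simp [dilateTranslate, mul_comm]

/-- The one-dimensional wavelets, `φ(x - k)` for `j = -1` and `ψ(2 ^ j x - k)` for `j ≥ 0`. -/
def wavelet1D (m : MeyerProfile) (j k : ℤ) : 𝓢(ℝ, ℂ) :=
  if j = -1 then dilateTranslate m.scaling 0 k else dilateTranslate m.wavelet j k

theorem decay_one (g : 𝓢(ℝ, ℂ)) (k n : ℕ) :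
    ∃ C : ℝ, 0 ≤ C ∧ ∀ t : ℝ, (1 + ‖t‖) ^ k * ‖iteratedFDeriv ℝ n g t‖ ≤ C := by
  refine ⟨2 ^ k * ((Finset.Iic (k, n)).sup fun m => SchwartzMap.seminorm ℝ m.1 m.2) g,
    by positivity, fun t => ?_⟩
  exact SchwartzMap.one_add_le_sup_seminorm_apply (m := (k, n)) le_rfl le_rfl g t

theorem norm_iteratedFDeriv_coord (g : 𝓢(ℝ, ℂ)) (i : Fin 2) (n : ℕ) (x : Plane) :
    ‖iteratedFDeriv ℝ n (fun x : Plane => g (x i)) x‖ ≤ ‖iteratedFDeriv ℝ n g (x i)‖ := by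
  have h := (EuclideanSpace.proj i : Plane →L[ℝ] ℝ).iteratedFDeriv_comp_right
    (g.smooth ⊤) x (i := n) (mod_cast le_top)
  have hp : ‖(EuclideanSpace.proj i : Plane →L[ℝ] ℝ)‖ ≤ 1 :=
    ContinuousLinearMap.opNorm_le_bound _ zero_le_one fun y => by
      simpa using PiLp.norm_apply_le y i
  have h2 : iteratedFDeriv ℝ n (fun x : Plane => g (x i)) x = _ := h
  rw [h2]
  refine (ContinuousMultilinearMap.norm_compContinuousLinearMap_le _ _).trans ?_
  refine mul_le_of_le_one_right (norm_nonneg _) ?_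
  exact Finset.prod_le_one (fun _ _ => norm_nonneg _) fun _ _ => hp

theorem decay_tensor (g h : 𝓢(ℝ, ℂ)) (k n : ℕ) : ∃ C : ℝ, ∀ x : Plane,
    ‖x‖ ^ k * ‖iteratedFDeriv ℝ n (fun x : Plane => g (x 0) * h (x 1)) x‖ ≤ C := by
  choose A hA0 hA using fun i => decay_one g k i
  choose B hB0 hB using fun i => decay_one h k i
  refine ⟨∑ i ∈ Finset.range (n + 1), (n.choose i : ℝ) * (A i * B (n - i)), fun x => ?_⟩
  have hg : ContDiff ℝ ∞ fun x : Plane => g (x 0) :=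
    (g.smooth ⊤).comp (EuclideanSpace.proj (𝕜 := ℝ) (0 : Fin 2)).contDiff
  have hh : ContDiff ℝ ∞ fun x : Plane => h (x 1) :=
    (h.smooth ⊤).comp (EuclideanSpace.proj (𝕜 := ℝ) (1 : Fin 2)).contDiff
  have hx : ‖x‖ ≤ (1 + ‖x 0‖) * (1 + ‖x 1‖) := by
    have h1 : ‖x‖ ≤ ‖x 0‖ + ‖x 1‖ := by
      rw [EuclideanSpace.norm_eq, Fin.sum_univ_two]
      refine Real.sqrt_le_iff.2 ⟨by positivity, ?_⟩
      nlinarith [norm_nonneg (x 0), norm_nonneg (x 1)]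
    nlinarith [norm_nonneg (x 0), norm_nonneg (x 1)]
  have hk : ‖x‖ ^ k ≤ (1 + ‖x 0‖) ^ k * (1 + ‖x 1‖) ^ k := by
    rw [← mul_pow]
    exact pow_le_pow_left₀ (norm_nonneg _) hx k
  calc _ ≤ ((1 + ‖x 0‖) ^ k * (1 + ‖x 1‖) ^ k) *
        ∑ i ∈ Finset.range (n + 1), (n.choose i : ℝ) *
          ‖iteratedFDeriv ℝ i (fun x : Plane => g (x 0)) x‖ *
          ‖iteratedFDeriv ℝ (n - i) (fun x : Plane => h (x 1)) x‖ := by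
        gcongr
        exact norm_iteratedFDeriv_mul_le hg hh x (mod_cast le_top)
    _ ≤ _ := by
        rw [Finset.mul_sum]
        refine Finset.sum_le_sum fun i _ => ?_
        have h1 := (mul_le_mul_of_nonneg_left (norm_iteratedFDeriv_coord g 0 i x)
          (show 0 ≤ (1 + ‖x 0‖) ^ k by positivity)).trans (hA i (x 0))
        have h2 := (mul_le_mul_of_nonneg_left (norm_iteratedFDeriv_coord h 1 (n - i) x)
          (show 0 ≤ (1 + ‖x 1‖) ^ k by positivity)).trans (hB (n - i) (x 1))
        have h3 := mul_le_mul h1 h2 (by positivity) (hA0 i)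
        calc _ = (n.choose i : ℝ) * ((1 + ‖x 0‖) ^ k *
              ‖iteratedFDeriv ℝ i (fun x : Plane => g (x 0)) x‖ * ((1 + ‖x 1‖) ^ k *
              ‖iteratedFDeriv ℝ (n - i) (fun x : Plane => h (x 1)) x‖)) := by ring
          _ ≤ _ := by gcongr

/-- The tensor product `(x₁, x₂) ↦ g(x₁) h(x₂)` of two Schwartz functions. -/
def tensor (g h : 𝓢(ℝ, ℂ)) : 𝓢(Plane, ℂ) where
  toFun x := g (x 0) * h (x 1)
  smooth' := ((g.smooth ⊤).comp (EuclideanSpace.proj (𝕜 := ℝ) (0 : Fin 2)).contDiff).mul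
    ((h.smooth ⊤).comp (EuclideanSpace.proj (𝕜 := ℝ) (1 : Fin 2)).contDiff)
  decay' := decay_tensor g h

/-- The hyperbolic wavelets `ψ_{j₁,j₂,k₁,k₂}`, for `j₁, j₂ ≥ -1`. -/
def hyperbolicWavelet (m : MeyerProfile) (j k : ℤ × ℤ) : 𝓢(Plane, ℂ) :=
  tensor (wavelet1D m j.1 k.1) (wavelet1D m j.2 k.2)

/-- The hyperbolic wavelet coefficients `c_{j₁,j₂,k₁,k₂} = 2 ^ (j₁⁺ + j₂⁺) ⟨f, ψ_{j₁,j₂,k₁,k₂}⟩`: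
an index `-1` contributes no factor. -/
def waveletCoeff (m : MeyerProfile) (f : 𝓢'(Plane, ℂ)) (j k : ℤ × ℤ) : ℂ :=
  (2 : ℂ) ^ (max j.1 0 + max j.2 0) * f (hyperbolicWavelet m j k)

/-- The norm `‖c_{j₁,j₂,·,·}‖_{ℓ²}`, with values in `[0, ∞]`. -/
def coeffL2Norm (m : MeyerProfile) (f : 𝓢'(Plane, ℂ)) (j : ℤ × ℤ) : ℝ≥0∞ :=
  (∑' k : ℤ × ℤ, ‖waveletCoeff m f j k‖ₑ ^ 2) ^ (1 / 2 : ℝ)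

/-! ### The index sets -/

/-- High frequencies at scale `j` along the direction of exponent `a`. -/
def highRange (a : ℝ) (j : ℕ) : Set ℤ :=
  {l | -1 ≤ l ∧ ⌊((j : ℝ) - 1) * a⌋ - 1 ≤ l ∧ l ≤ ⌊(j : ℝ) * a⌋ + 1}

/-- Low frequencies at scale `j` along the direction of exponent `a`. -/
def lowRange (a : ℝ) (j : ℕ) : Set ℤ :=
  {l | -1 ≤ l ∧ l ≤ ⌊((j : ℝ) - 1) * a⌋ - 1}

/-- The set `Γⱼ(α)`, the union of its parts `HL`, `LH` and `HH`. -/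
def Gam (α : Fin 2 → ℝ) (j : ℕ) : Set (ℤ × ℤ) :=
  highRange (α 0) j ×ˢ lowRange (α 1) j ∪ lowRange (α 0) j ×ˢ highRange (α 1) j ∪
    highRange (α 0) j ×ˢ highRange (α 1) j

end HyperbolicWavelet

end

/-!
The two conditions compare, up to constants, the weighted `ℓ²` sums of two families of quantities:
the norms `Dⱼ = ‖Δⱼ f‖_{L²}` of the Littlewood-Paley blocks, and the energies `Eⱼ` of the
`L²`-normalized wavelet coefficients of `f` with levels in `Γⱼ(α)`. As the weights `2^{2js}` of
neighbouring scales are comparable, it is enough to bound `Dⱼ²` by the `E_k`, and `Eⱼ` by the `D_k²`,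
with `|k - j| ≤ C` and a constant `C` that depends on `α` only (`tsum_rpow_mul_lt_top`).

The wavelets form a Parseval frame for band-limited Schwartz functions. On the Fourier side this is
the identity `u(η) = ∑_j b_j(η) ∑_n conj b_j(η + λ_j n) u(η + λ_j n)`, in each variable, for
compactly supported `u`, where `λ_j = 2^{max(j,0)}` and `b_j` is `φ̂` or `ψ̂` dilated to level `j`.
It telescopes because of `cos² + sin² = 1` and of the symmetry `ν(x) + ν(1 - x) = 1` of the profile
(`MeyerProfile.sum_foldProd_freq`). Poisson summation (`poisson_plane`) turns the inner sums into
wavelet series. Those converge in the Schwartz topology, so that any tempered distribution, and not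
only an `L²` function, can be applied to them term by term (`hasSum_wavelet`, `parseval_wavelet`).

Both bounds are then obtained by duality, since a tempered distribution lies in `L²` with norm at
most `K` as soon as it is bounded by `K ‖u‖_{L²}` on Schwartz functions `u`
(`distL2Norm_le_of_bound`).

* `distL2Norm_anisoBlock_sq_le`: testing `Δⱼ f` against `u` is testing `f` against a band-limited
  function with frequencies in the support of `φⱼ`. Its wavelet expansion only involves levels from
  `Γ_k(α)` with `k` near `j` (`exists_near`), and the Cauchy-Schwarz inequality concludes.
* `tsum_levelEnergy_le`: a finite part of `Eⱼ` equals `⟨f, g⟩` for the combination `g` of wavelets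
  with the conjugate coefficients. The functions `φ_k` with `k` near `j` sum to `1` on the
  frequencies of `g` (`sum_near_eq_one`), so `⟨f, g⟩ = ∑_k ⟨Δ_k f, g⟩ ≤ (∑_k D_k) ‖g‖_{L²}`, and
  Bessel's inequality bounds `‖g‖_{L²}²` by the same part of `Eⱼ`.
-/

noncomputable section

namespace HyperbolicWavelet

/-! ### The one-dimensional Meyer identity -/

namespace MeyerProfile

variable (m : MeyerProfile)

/-- The Fourier transform of the Meyer scaling function in the frequency variable `η = ξ / (2π)`. -/
def low (η : ℝ) : ℝ := Real.cos (Real.pi / 2 * m.ν (3 * |η| - 1))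

/-- The high-pass function with `low ^ 2 + high ^ 2 = 1`, in the variable `η = ξ / (2π)`. -/
def high (η : ℝ) : ℝ := Real.sin (Real.pi / 2 * m.ν (3 * |η| - 1))

theorem abs_two_pi_mul (η : ℝ) : |2 * Real.pi * η| = 2 * Real.pi * |η| := by
  rw [abs_mul, abs_of_pos Real.two_pi_pos]

theorem scalingHat_two_pi (η : ℝ) : m.scalingHat (2 * Real.pi * η) = m.low η := by
  have h : 3 / (2 * Real.pi) * |2 * Real.pi * η| = 3 * |η| := by
    rw [abs_two_pi_mul]; field_simp
  rw [scalingHat, low, h]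

theorem waveletHat_two_pi (η : ℝ) : m.waveletHat (2 * Real.pi * η) =
    Complex.exp (Complex.I * ((Real.pi * η : ℝ) : ℂ)) * ((m.high η * m.low (η / 2) : ℝ) : ℂ) := by
  have h : 3 / (2 * Real.pi) * |2 * Real.pi * η| = 3 * |η| := by
    rw [abs_two_pi_mul]; field_simp
  have h' : 3 / (4 * Real.pi) * |2 * Real.pi * η| = 3 * |η / 2| := by
    rw [abs_two_pi_mul, abs_div, abs_two]; field_simp; norm_num
  have h2 : 2 * Real.pi * η / 2 = Real.pi * η := by ring
  rw [waveletHat, low, high, h, h', h2]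

theorem low_neg (η : ℝ) : m.low (-η) = m.low η := by simp [low]

theorem high_neg (η : ℝ) : m.high (-η) = m.high η := by simp [high]

theorem low_eq_one {η : ℝ} (h : |η| ≤ 1 / 3) : m.low η = 1 := by
  simp [low, m.eq_zero (3 * |η| - 1) (by linarith)]

theorem low_eq_zero {η : ℝ} (h : 2 / 3 ≤ |η|) : m.low η = 0 := by
  simp [low, m.eq_one (3 * |η| - 1) (by linarith)]

theorem high_eq_zero {η : ℝ} (h : |η| ≤ 1 / 3) : m.high η = 0 := by
  simp [high, m.eq_zero (3 * |η| - 1) (by linarith)]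

theorem high_eq_one {η : ℝ} (h : 2 / 3 ≤ |η|) : m.high η = 1 := by
  simp [high, m.eq_one (3 * |η| - 1) (by linarith)]

theorem high_sq (η : ℝ) : m.high η ^ 2 = 1 - m.low η ^ 2 := by
  rw [high, low, Real.sin_sq]

/-- The symmetry `ν(x) + ν(1 - x) = 1` exchanges the two filters at distance `1`. -/
theorem high_eq_low {η : ℝ} (h0 : 0 ≤ η) (h1 : η ≤ 1) : m.high η = m.low (η - 1) := by
  have h := m.add_eq_one (3 * η - 1)
  have e : m.ν (3 * |η - 1| - 1) = 1 - m.ν (3 * |η| - 1) := by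
    rw [abs_of_nonneg h0, abs_of_nonpos (by linarith)]
    have : 3 * -(η - 1) - 1 = 1 - (3 * η - 1) := by ring
    rw [this]; linarith
  rw [high, low, e, mul_sub, mul_one, Real.cos_pi_div_two_sub]

theorem high_eq_low' {η : ℝ} (h0 : -1 ≤ η) (h1 : η ≤ 0) : m.high η = m.low (η + 1) := by
  rw [← high_neg, m.high_eq_low (by linarith) (by linarith), ← low_neg]
  congr 1; ring

/-- The aliasing terms at shift `1` of one wavelet step and of the two scaling projections
cancel. -/
theorem kernel_one (η : ℝ) : m.low η * m.low (η + 1) =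
    m.high η * m.high (η + 1) * m.low (η / 2) * m.low ((η + 1) / 2) := by
  have a2 : |η / 2| = |η| / 2 := by rw [abs_div, abs_two]
  have a3 : |(η + 1) / 2| = |η + 1| / 2 := by rw [abs_div, abs_two]
  rcases le_total η 0 with h | h
  · rcases le_total (-1) η with h' | h'
    · rw [m.high_eq_low' h' h, m.high_eq_low (by linarith : 0 ≤ η + 1) (by linarith),
        add_sub_cancel_right]
      by_cases c1 : 2 / 3 ≤ |η|
      · simp [m.low_eq_zero c1]
      by_cases c2 : 2 / 3 ≤ |η + 1|
      · simp [m.low_eq_zero c2]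
      rw [m.low_eq_one (η := η / 2) (by linarith), m.low_eq_one (η := (η + 1) / 2) (by linarith)]
      ring
    · have e := abs_of_nonpos h
      have e' := abs_of_nonpos (by linarith : η + 1 ≤ 0)
      rw [m.low_eq_zero (η := η) (by linarith)]
      by_cases c1 : |η + 1| ≤ 1 / 3
      · simp [m.high_eq_zero c1]
      · simp [m.low_eq_zero (η := η / 2) (by linarith)]
  · have e := abs_of_nonneg h
    have e' := abs_of_nonneg (by linarith : 0 ≤ η + 1)
    rw [m.low_eq_zero (η := η + 1) (by linarith)]
    by_cases c1 : |η| ≤ 1 / 3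
    · simp [m.high_eq_zero c1]
    · simp [m.low_eq_zero (η := (η + 1) / 2) (by linarith)]

/-- For two points at distance at least `2`, either one of them is at least `4 / 3` in absolute value
and all the terms vanish, or both lie where `low` is `0` and `high` is `1`. -/
theorem kernel_two {η θ : ℝ} (hs : 2 ≤ |θ - η|) :
    m.low (η / 2) * m.low (θ / 2) - m.low η * m.low θ =
      m.high η * m.high θ * m.low (η / 2) * m.low (θ / 2) := by
  have a2 : |η / 2| = |η| / 2 := by rw [abs_div, abs_two]
  have a3 : |θ / 2| = |θ| / 2 := by rw [abs_div, abs_two]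
  have tr : |θ - η| ≤ |θ| + |η| := abs_sub _ _
  by_cases c1 : 4 / 3 ≤ |η|
  · rw [m.low_eq_zero (η := η / 2) (by linarith), m.low_eq_zero (η := η) (by linarith)]; ring
  by_cases c2 : 4 / 3 ≤ |θ|
  · rw [m.low_eq_zero (η := θ / 2) (by linarith), m.low_eq_zero (η := θ) (by linarith)]; ring
  rw [m.high_eq_one (η := η) (by linarith), m.high_eq_one (η := θ) (by linarith),
    m.low_eq_zero (η := θ) (by linarith)]
  ring

/-- The Meyer identity for the aliasing kernels: passing from the scaling projection of scale `0`
to that of scale `1` adds the kernel of one wavelet step. -/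
theorem kernel_step (η : ℝ) (n : ℤ) :
    (if Even n then m.low (η / 2) * m.low ((η + n) / 2) else 0) - m.low η * m.low (η + n) =
      (-1) ^ n * (m.high η * m.high (η + n) * m.low (η / 2) * m.low ((η + n) / 2)) := by
  have a2 : |η / 2| = |η| / 2 := by rw [abs_div, abs_two]
  rcases Int.even_or_odd n with hn | hn
  · rw [if_pos hn, hn.neg_one_zpow, one_mul]
    by_cases h0 : n = 0
    · subst h0
      have hs := m.high_sq η
      by_cases c1 : 2 / 3 ≤ |η|
      · simp only [Int.cast_zero, add_zero, m.low_eq_zero c1, m.high_eq_one c1]; ring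
      · simp only [Int.cast_zero, add_zero, m.low_eq_one (η := η / 2) (by linarith)]
        linear_combination -hs
    · refine m.kernel_two ?_
      obtain ⟨k, rfl⟩ := hn
      have : 1 ≤ |k| := Int.one_le_abs (by omega)
      have h' : (1 : ℝ) ≤ |(k : ℝ)| := by exact_mod_cast this
      have : η + ((k + k : ℤ) : ℝ) - η = 2 * k := by push_cast; ring
      rw [this, abs_mul, abs_two]; linarith
  · rw [if_neg (by simpa using hn), hn.neg_one_zpow]
    by_cases h1 : n = 1
    · subst h1; have := m.kernel_one η; push_cast; linarith
    by_cases h2 : n = -1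
    · subst h2
      have := m.kernel_one (-η)
      have e : -η + 1 = -(η + (-1 : ℤ)) := by push_cast; ring
      rw [e, neg_div, neg_div, low_neg, low_neg, low_neg, low_neg, high_neg, high_neg] at this
      linarith
    have h3 : (3 : ℝ) ≤ |(n : ℝ)| := by
      have : 3 ≤ |n| := by
        obtain ⟨k, rfl⟩ := hn
        rcases abs_cases (2 * k + 1) with h | h <;> omega
      exact_mod_cast this
    have hk := m.kernel_two (η := η) (θ := η + n) (by rw [add_sub_cancel_left]; linarith)
    have tr : |(n : ℝ)| ≤ |η + n| + |η| := by
      have := abs_sub (η + n) η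
      rwa [add_sub_cancel_left] at this
    have a3 : |(η + n) / 2| = |η + n| / 2 := by rw [abs_div, abs_two]
    have : m.low (η / 2) * m.low ((η + n) / 2) = 0 := by
      by_cases c : 4 / 3 ≤ |η|
      · rw [m.low_eq_zero (η := η / 2) (by linarith), zero_mul]
      · rw [m.low_eq_zero (η := (η + n) / 2) (by linarith), mul_zero]
    linear_combination hk + (2 * m.high η * m.high (η + n) - 1) * this

/-- The dyadic scale `2 ^ j`, with the convention that the scaling functions, of index `-1`, have
scale `1`. -/
def _root_.HyperbolicWavelet.scale (j : ℤ) : ℝ := (2 : ℝ) ^ max j 0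

theorem _root_.HyperbolicWavelet.scale_pos (j : ℤ) : 0 < scale j := by
  unfold scale; positivity

/-- The profile in frequency, as a function of `η = ξ / (2π)`, of the wavelets of index `j`, which
is the index `-1` for the scaling functions. -/
def freq (j : ℤ) (η : ℝ) : ℂ :=
  if j = -1 then m.scalingHat (2 * Real.pi * η) else m.waveletHat (2 * Real.pi * (η / scale j))

/-- The periodized product at scale `L`: the operator `u ↦ b · Σₙ (b̄ u)(· + L n)`. -/
def _root_.HyperbolicWavelet.foldProd (b : ℝ → ℂ) (L : ℝ) (u : ℝ → ℂ) (η : ℝ) : ℂ :=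
  b η * ∑' n : ℤ, (starRingEnd ℂ) (b (η + L * n)) * u (η + L * n)

theorem _root_.HyperbolicWavelet.finite_support_shift {u : ℝ → ℂ} {R L : ℝ} (hL : 0 < L)
    (hu : ∀ t, R < |t| → u t = 0) (η : ℝ) :
    (Function.support fun n : ℤ => u (η + L * n)).Finite := by
  refine (Set.finite_Icc ⌊(-R - η) / L⌋ ⌈(R - η) / L⌉).subset fun n hn => ?_
  have h : |η + L * n| ≤ R := by
    by_contra hc
    exact hn (hu _ (not_le.mp hc))
  obtain ⟨h1, h2⟩ := abs_le.mp h
  have h3 : (-R - η) / L ≤ n := by rw [div_le_iff₀ hL]; linarith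
  have h4 : (n : ℝ) ≤ (R - η) / L := by rw [le_div_iff₀ hL]; linarith
  refine ⟨?_, ?_⟩
  · exact_mod_cast (Int.floor_le _).trans h3
  · exact_mod_cast h4.trans (Int.le_ceil _)

theorem _root_.HyperbolicWavelet.summable_shift {u : ℝ → ℂ} {R L : ℝ} (hL : 0 < L)
    (hu : ∀ t, R < |t| → u t = 0) (η : ℝ) (c : ℤ → ℂ) :
    Summable fun n : ℤ => c n * u (η + L * n) :=
  summable_of_hasFiniteSupport ((finite_support_shift hL hu η).subset fun n hn => by
    simp only [Function.mem_support] at hn ⊢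
    exact right_ne_zero_of_mul hn)

/-- The scaling projection onto scale `2 L` is the sum of that onto scale `L` and of the wavelet
operator of scale `L`. -/
theorem foldProd_low_two_mul {u : ℝ → ℂ} {R L : ℝ} (hL : 0 < L) (hu : ∀ t, R < |t| → u t = 0)
    (η : ℝ) :
    foldProd (fun t => (m.low (t / (2 * L)) : ℂ)) (2 * L) u η =
      foldProd (fun t => (m.low (t / L) : ℂ)) L u η +
        foldProd (fun t => m.waveletHat (2 * Real.pi * (t / L))) L u η := by
  have hinj : Function.Injective fun n : ℤ => 2 * n := fun a b h => by simpa using h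
  have e1 : ∑' n : ℤ, (starRingEnd ℂ) (m.low ((η + 2 * L * n) / (2 * L)) : ℂ) * u (η + 2 * L * n)
      = ∑' n : ℤ, (if Even n then (m.low ((η + L * n) / (2 * L)) : ℂ) else 0) * u (η + L * n) := by
    rw [← hinj.tsum_eq (f := fun n : ℤ =>
      (if Even n then (m.low ((η + L * n) / (2 * L)) : ℂ) else 0) * u (η + L * n))]
    · refine tsum_congr fun n => ?_
      have e : η + L * ((2 * n : ℤ) : ℝ) = η + 2 * L * n := by push_cast; ring
      simp only [even_two_mul, if_true, e, Complex.conj_ofReal]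
    · intro n hn
      by_contra hc
      refine hn ?_
      have : ¬ Even n := fun ⟨k, hk⟩ => hc ⟨k, by simp only; omega⟩
      simp [this]
  simp only [foldProd]
  rw [e1, ← tsum_mul_left, ← tsum_mul_left, ← tsum_mul_left]
  simp only [← mul_assoc]
  rw [← (summable_shift hL hu η _).tsum_add (summable_shift hL hu η _)]
  refine tsum_congr fun n => ?_
  rw [← add_mul]
  congr 1
  have hk := m.kernel_step (η / L) n
  have s1 : (η + L * n) / L = η / L + n := by field_simp
  have s2 : η / (2 * L) = η / L / 2 := by field_simp
  have s3 : (η + L * n) / (2 * L) = (η / L + n) / 2 := by field_simp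
  rw [waveletHat_two_pi, waveletHat_two_pi, s1, s2, s3]
  generalize η / L = x at hk
  -- The half-integer shift of the wavelet, that is the phase `exp (i π η)`, produces the sign.
  have hph : Complex.exp (Complex.I * ((Real.pi * x : ℝ) : ℂ)) *
      (starRingEnd ℂ) (Complex.exp (Complex.I * ((Real.pi * (x + n) : ℝ) : ℂ))) = (-1) ^ n := by
    rw [← Complex.exp_conj, ← Complex.exp_add, map_mul, Complex.conj_I, Complex.conj_ofReal]
    have : Complex.I * ((Real.pi * x : ℝ) : ℂ) + -Complex.I * ((Real.pi * (x + n) : ℝ) : ℂ) =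
        ((-n : ℤ) : ℂ) * (Real.pi * Complex.I) := by push_cast; ring
    rw [this, Complex.exp_int_mul, Complex.exp_pi_mul_I, zpow_neg, ← inv_zpow]
    norm_num
  have hkc : (if Even n then (m.low (x / 2) : ℂ) * m.low ((x + n) / 2) else 0)
      - m.low x * m.low (x + n) =
      (-1) ^ n * (m.high x * m.high (x + n) * m.low (x / 2) * m.low ((x + n) / 2)) := by
    have e : (if Even n then (m.low (x / 2) : ℂ) * m.low ((x + n) / 2) else 0) =
        ((if Even n then m.low (x / 2) * m.low ((x + n) / 2) else 0 : ℝ) : ℂ) := by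
      split_ifs <;> simp
    rw [e]
    have h := congrArg Complex.ofReal hk
    simp only [Complex.ofReal_sub, Complex.ofReal_mul, Complex.ofReal_zpow, Complex.ofReal_neg,
      Complex.ofReal_one] at h
    exact h
  rw [map_mul, Complex.conj_ofReal, Complex.conj_ofReal]
  push_cast at hph ⊢
  have hite : (m.low (x / 2) : ℂ) * (if Even n then (m.low ((x + n) / 2) : ℂ) else 0) =
      if Even n then (m.low (x / 2) : ℂ) * m.low ((x + n) / 2) else 0 := by
    split_ifs <;> simp
  rw [hite]
  linear_combination hkc - m.high x * m.low (x / 2) * m.high (x + n) * m.low ((x + n) / 2) * hph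

theorem foldProd_low_eq_self {u : ℝ → ℂ} {L : ℝ} (hL : 0 < L)
    (hu : ∀ t, L / 3 < |t| → u t = 0) (η : ℝ) :
    foldProd (fun t => (m.low (t / L) : ℂ)) L u η = u η := by
  have habs : ∀ t : ℝ, |t / L| = |t| / L := fun t => by rw [abs_div, abs_of_pos hL]
  rw [foldProd, ← tsum_mul_left, tsum_eq_single 0]
  · by_cases h : L / 3 < |η|
    · simp [hu η h]
    · rw [m.low_eq_one (η := η / L) (by rw [habs, div_le_iff₀ hL]; linarith)]
      simp [m.low_eq_one (η := η / L) (by rw [habs, div_le_iff₀ hL]; linarith)]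
  · intro n hn
    by_cases h : L / 3 < |η + L * n|
    · simp [hu _ h]
    · rw [m.low_eq_zero (η := η / L)]
      · simp
      · have h1 : (1 : ℝ) ≤ |(n : ℝ)| := by exact_mod_cast Int.one_le_abs hn
        have h2 : |L * n| ≤ |η + L * n| + |η| := by
          have := abs_sub (η + L * n) η
          rwa [add_sub_cancel_left] at this
        rw [abs_mul, abs_of_pos hL] at h2
        rw [habs, le_div_iff₀ hL]
        nlinarith

/-- The Meyer identity: a function supported in `|η| ≤ 2 ^ J / 3` is the sum of its components of
index `-1, 0, …, J - 1`. -/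
theorem sum_foldProd_freq {u : ℝ → ℂ} {J : ℕ} (hu : ∀ t, (2 : ℝ) ^ J / 3 < |t| → u t = 0)
    (η : ℝ) :
    ∑ j ∈ Finset.Ico (-1 : ℤ) J, foldProd (m.freq j) (scale j) u η = u η := by
  have key : ∀ K : ℕ, ∑ j ∈ Finset.Ico (-1 : ℤ) K, foldProd (m.freq j) (scale j) u η =
      foldProd (fun t => (m.low (t / 2 ^ K) : ℂ)) (2 ^ K) u η := by
    intro K
    induction K with
    | zero =>
      have : Finset.Ico (-1 : ℤ) (0 : ℕ) = {-1} := by decide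
      rw [this, Finset.sum_singleton]
      have e : m.freq (-1) = fun t => (m.low (t / 2 ^ 0) : ℂ) := by
        funext t; simp [freq, scalingHat_two_pi]
      rw [e]; simp [scale]
    | succ K ih =>
      have hI : Finset.Ico (-1 : ℤ) ((K + 1 : ℕ) : ℤ) = insert (K : ℤ) (Finset.Ico (-1 : ℤ) K) := by
        ext x; simp only [Finset.mem_insert, Finset.mem_Ico]; push_cast; omega
      rw [hI, Finset.sum_insert (by simp), ih, add_comm, pow_succ',
        m.foldProd_low_two_mul (by positivity) hu]
      congr 1
      have hs : scale (K : ℤ) = 2 ^ K := by simp [scale]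
      have e : m.freq (K : ℤ) = fun t => m.waveletHat (2 * Real.pi * (t / 2 ^ K)) := by
        funext t; rw [freq, if_neg (by omega), hs]
      rw [e, hs]
  rw [key, m.foldProd_low_eq_self (by positivity) hu]

end MeyerProfile

/-! ### Poisson summation in the plane -/

/-- The character `t ↦ exp (2 π i t)` of the line, with values in `ℂ`. -/
def chi (t : ℝ) : ℂ := ((Real.fourierChar t : Circle) : ℂ)

theorem chi_eq (t : ℝ) : chi t = Complex.exp ((2 * Real.pi * t : ℝ) * Complex.I) :=
  Real.fourierChar_apply t

@[simp] theorem norm_chi (t : ℝ) : ‖chi t‖ = 1 := Circle.norm_coe _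

theorem continuous_chi : Continuous chi :=
  continuous_subtype_val.comp Real.continuous_fourierChar

theorem chi_add (s t : ℝ) : chi (s + t) = chi s * chi t := by
  rw [chi, AddChar.map_add_eq_mul, Circle.coe_mul]; rfl

theorem conj_chi (t : ℝ) : (starRingEnd ℂ) (chi t) = chi (-t) := by
  rw [chi, chi, AddChar.map_neg_eq_inv, Circle.coe_inv_eq_conj]

theorem poisson_line {g : ℝ → ℂ} {R L : ℝ} (hg : Continuous g) (hR : ∀ t, R < |t| → g t = 0)
    (hL : 0 < L)
    (hs : Summable fun k : ℤ => ∫ t, chi (-(k / L * t)) * g t) (x : ℝ) :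
    ∑' n : ℤ, g (x + L * n) = (L : ℂ)⁻¹ * ∑' k : ℤ, chi (k / L * x) *
      ∫ t, chi (-(k / L * t)) * g t := by
  have hLc : (L : ℂ) ≠ 0 := by exact_mod_cast hL.ne'
  have hF : ∀ k : ℤ, 𝓕 (fun t => g (L * t)) (k : ℝ) =
      (L : ℂ)⁻¹ * ∫ t, chi (-(k / L * t)) * g t := by
    intro k
    rw [Real.fourier_real_eq]
    have := Measure.integral_comp_mul_left
      (fun t => chi (-(k / L * t)) * g t) L
    rw [abs_of_pos (inv_pos.2 hL), Complex.real_smul, Complex.ofReal_inv] at this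
    rw [← this]
    refine integral_congr_ae (Filter.Eventually.of_forall fun t => ?_)
    have e : (k : ℝ) / L * (L * t) = t * k := by field_simp
    simp only [e]
    rfl
  have h0 : (fun t => g (L * t)) =ᶠ[Filter.cocompact ℝ] fun _ => 0 := by
    have : (Metric.closedBall (0 : ℝ) (R / L))ᶜ ∈ Filter.cocompact ℝ :=
      (isCompact_closedBall _ _).compl_mem_cocompact
    filter_upwards [this] with t ht
    refine hR _ ?_
    rw [abs_mul, abs_of_pos hL]
    have : R / L < |t| := by simpa using ht
    rwa [div_lt_iff₀' hL] at this
  have h := Real.tsum_eq_tsum_fourier_of_rpow_decay_of_summable (f := fun t => g (L * t))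
    (by fun_prop) one_lt_two
    (h0.trans_isBigO (Asymptotics.isBigO_zero _ _))
    (by simp only [hF]; exact hs.mul_left _) (x / L)
  have e1 : ∀ n : ℤ, L * (x / L + n) = x + L * n := fun n => by field_simp
  simp only [e1] at h
  rw [h, ← tsum_mul_left]
  refine tsum_congr fun k => ?_
  rw [hF, fourier_coe_apply, chi_eq]
  have e2 : 2 * (Real.pi : ℂ) * Complex.I * k * ((x / L : ℝ) : ℂ) / ((1 : ℝ) : ℂ) =
      ((2 * Real.pi * (k / L * x) : ℝ) : ℂ) * Complex.I := by
    push_cast; ring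
  rw [e2]; ring

/-- The Fourier transform of a function of two variables at a point of the lattice dual to
`L₁ ℤ × L₂ ℤ`, as an iterated integral. -/
def latticeFourier (g : ℝ → ℝ → ℂ) (L₁ L₂ : ℝ) (k : ℤ × ℤ) : ℂ :=
  ∫ s, chi (-(k.1 / L₁ * s)) *
    ∫ t, chi (-(k.2 / L₂ * t)) * g s t

theorem poisson_plane {g : ℝ → ℝ → ℂ} {R L₁ L₂ : ℝ} (hg : Continuous (Function.uncurry g))
    (hR₁ : ∀ s t, R < |s| → g s t = 0) (hR₂ : ∀ s t, R < |t| → g s t = 0)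
    (hL₁ : 0 < L₁) (hL₂ : 0 < L₂) (hs : Summable (latticeFourier g L₁ L₂)) (x y : ℝ) :
    ∑' n₂ : ℤ, ∑' n₁ : ℤ, g (x + L₁ * n₁) (y + L₂ * n₂) = ((L₁ : ℂ) * L₂)⁻¹ *
      ∑' k : ℤ × ℤ, chi (k.1 / L₁ * x) * chi (k.2 / L₂ * y) *
        latticeFourier g L₁ L₂ k := by
  set h : ℤ → ℝ → ℂ := fun k₂ s => ∫ t, chi (-(k₂ / L₂ * t)) * g s t with hh
  have hcont : ∀ k₂, Continuous (h k₂) := by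
    intro k₂
    have e : h k₂ = fun s => ∫ t in Set.Icc (-R) R, chi (-(k₂ / L₂ * t)) * g s t
    · funext s
      rw [setIntegral_eq_integral_of_forall_compl_eq_zero]
      intro t ht
      rw [hR₂ s t, mul_zero]
      by_contra hc
      exact ht (abs_le.mp (not_lt.mp hc))
    rw [e]
    refine continuous_parametric_integral_of_continuous ?_ isCompact_Icc
    have h1 : Continuous fun p : ℝ × ℝ => chi (-(k₂ / L₂ * p.2)) :=
      continuous_chi.comp (by fun_prop)
    exact h1.mul hg
  have hsupp : ∀ k₂ s, R < |s| → h k₂ s = 0 := fun k₂ s hs' => by simp [hh, hR₁ s _ hs']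
  have hA : ∀ k₁ k₂ : ℤ, latticeFourier g L₁ L₂ (k₁, k₂) =
    ∫ s, chi (-(k₁ / L₁ * s)) * h k₂ s := fun _ _ => rfl
  -- Summation over the first lattice direction, one dual frequency of the second at a time.
  have hP₁ : ∀ k₂, ∑' n₁ : ℤ, h k₂ (x + L₁ * n₁) = (L₁ : ℂ)⁻¹ * ∑' k₁ : ℤ,
      chi (k₁ / L₁ * x) * latticeFourier g L₁ L₂ (k₁, k₂) := fun k₂ =>
    poisson_line (hcont k₂) (hsupp k₂) hL₁
      (hs.comp_injective (i := fun k₁ => (k₁, k₂)) fun a b hab => (Prod.mk.inj hab).1) x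
  have hfin := finite_support_shift (u := fun t => if R < |t| then (0 : ℂ) else 1) hL₁
    (fun t ht => if_pos ht) x
  set N := hfin.toFinset with hN
  have hNz : ∀ n : ℤ, n ∉ N → R < |x + L₁ * n| := fun n hn => by
    by_contra hc
    exact hn (hfin.mem_toFinset.2 (by simp [hc]))
  set G : ℝ → ℂ := fun t => ∑ n ∈ N, g (x + L₁ * n) t with hG
  have hGt : ∀ t, ∑' n₁ : ℤ, g (x + L₁ * n₁) t = G t := fun t =>
    tsum_eq_sum fun n hn => hR₁ _ _ (hNz n hn)
  have hGc : Continuous G := continuous_finsetSum _ fun n _ =>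
    hg.comp (continuous_const.prodMk continuous_id)
  have hGz : ∀ t, R < |t| → G t = 0 := fun t ht => Finset.sum_eq_zero fun n _ => hR₂ _ _ ht
  have hint : ∀ (k₂ : ℤ) (s : ℝ),
      Integrable fun t => chi (-(k₂ / L₂ * t)) * g s t := by
    intro k₂ s
    refine Continuous.integrable_of_hasCompactSupport ?_ ?_
    · have h1 : Continuous fun t : ℝ => chi (-(k₂ / L₂ * t)) :=
        continuous_chi.comp (by fun_prop)
      exact h1.mul (hg.comp (continuous_const.prodMk continuous_id))
    · refine HasCompactSupport.intro (isCompact_Icc (a := -R) (b := R)) fun t ht => ?_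
      rw [hR₂ s t, mul_zero]
      by_contra hc
      exact ht (abs_le.mp (not_lt.mp hc))
  have hGF : ∀ k₂ : ℤ, ∫ t, chi (-(k₂ / L₂ * t)) * G t = (L₁ : ℂ)⁻¹ * ∑' k₁ : ℤ,
      chi (k₁ / L₁ * x) * latticeFourier g L₁ L₂ (k₁, k₂) := by
    intro k₂
    rw [← hP₁, tsum_eq_sum fun n hn => hsupp k₂ _ (hNz n hn)]
    simp only [hG, Finset.mul_sum]
    rw [integral_finsetSum _ fun n _ => hint k₂ _]
  have hs' : Summable fun k : ℤ × ℤ =>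
      chi (k.1 / L₁ * x) * latticeFourier g L₁ L₂ k :=
    Summable.of_norm (by simpa using hs.norm)
  have hs'' : Summable fun k : ℤ × ℤ => chi (k.1 / L₁ * x) *
      chi (k.2 / L₂ * y) * latticeFourier g L₁ L₂ k :=
    Summable.of_norm (by simpa using hs.norm)
  have hsw : Summable fun k₂ : ℤ => ∑' k₁ : ℤ,
      chi (k₁ / L₁ * x) * latticeFourier g L₁ L₂ (k₁, k₂) :=
    hs'.prod_symm.prod
  simp only [hGt]
  rw [poisson_line hGc hGz hL₂ (by simp only [hGF]; exact hsw.mul_left _) y]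
  simp only [hGF]
  have hsw' : ∑' k : ℤ × ℤ, chi (k.1 / L₁ * x) * chi (k.2 / L₂ * y) * latticeFourier g L₁ L₂ k =
      ∑' k₂ : ℤ, ∑' k₁ : ℤ,
        chi (k₁ / L₁ * x) * chi (k₂ / L₂ * y) * latticeFourier g L₁ L₂ (k₁, k₂) := by
    rw [← (Equiv.prodComm ℤ ℤ).tsum_eq]
    exact Summable.tsum_prod ((Equiv.prodComm ℤ ℤ).summable_iff.2 hs'')
  rw [hsw', ← tsum_mul_left, ← tsum_mul_left]
  refine tsum_congr fun k₂ => ?_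
  simp only [← tsum_mul_left]
  refine tsum_congr fun k₁ => ?_
  rw [mul_inv]; ring

/-! ### Series in the Schwartz space -/

section SchwartzSeries

variable {E F : Type*} [NormedAddCommGroup E] [NormedSpace ℝ E] [NormedAddCommGroup F]
  [NormedSpace ℝ F] [CompleteSpace F]

theorem exists_schwartz_eq_tsum {ι : Type*} (g : ι → 𝓢(E, F))
    (h : ∀ k n, Summable fun i => SchwartzMap.seminorm ℝ k n (g i)) :
    ∃ U : 𝓢(E, F), (∀ x, U x = ∑' i, g i x) ∧
      ∀ k n, SchwartzMap.seminorm ℝ k n U ≤ ∑' i, SchwartzMap.seminorm ℝ k n (g i) := by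
  have hb : ∀ (n : ℕ) (i : ι) (x : E), (n : ℕ∞) ≤ (⊤ : ℕ∞) →
      ‖iteratedFDeriv ℝ n (g i) x‖ ≤ SchwartzMap.seminorm ℝ 0 n (g i) :=
    fun n i x _ => SchwartzMap.norm_iteratedFDeriv_le_seminorm ℝ (g i) n x
  have hd : ∀ (n : ℕ) (x : E), iteratedFDeriv ℝ n (fun y => ∑' i, g i y) x =
      ∑' i, iteratedFDeriv ℝ n (g i) x := fun n x =>
    iteratedFDeriv_tsum_apply (N := ⊤) (fun i => (g i).smooth ⊤) (fun n _ => h 0 n) hb le_top x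
  have hdec : ∀ (k n : ℕ) (x : E), ‖x‖ ^ k * ‖iteratedFDeriv ℝ n (fun y => ∑' i, g i y) x‖ ≤
      ∑' i, SchwartzMap.seminorm ℝ k n (g i) := by
    intro k n x
    have hn : Summable fun i => ‖iteratedFDeriv ℝ n (g i) x‖ :=
      (h 0 n).of_nonneg_of_le (fun _ => norm_nonneg _) fun i => hb n i x le_top
    rw [hd]
    calc _ ≤ ‖x‖ ^ k * ∑' i, ‖iteratedFDeriv ℝ n (g i) x‖ := by
          gcongr; exact norm_tsum_le_tsum_norm hn
      _ = ∑' i, ‖x‖ ^ k * ‖iteratedFDeriv ℝ n (g i) x‖ := tsum_mul_left.symm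
      _ ≤ _ := (hn.mul_left _).tsum_le_tsum
          (fun i => SchwartzMap.le_seminorm ℝ k n (g i) x) (h k n)
  exact ⟨⟨fun x => ∑' i, g i x,
    contDiff_tsum (N := ⊤) (fun i => (g i).smooth ⊤) (fun n _ => h 0 n) hb,
    fun k n => ⟨_, hdec k n⟩⟩, fun _ => rfl, fun k n => SchwartzMap.seminorm_le_bound ℝ k n _
      (tsum_nonneg fun i => apply_nonneg _ _) (hdec k n)⟩

/-- A series of Schwartz functions all of whose seminorms are summable converges in the Schwartz
space. -/
theorem schwartz_summable {ι : Type*} (g : ι → 𝓢(E, F))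
    (h : ∀ k n, Summable fun i => SchwartzMap.seminorm ℝ k n (g i)) : Summable g := by
  obtain ⟨U, hU, -⟩ := exists_schwartz_eq_tsum g h
  refine ⟨U, ?_⟩
  rw [HasSum, SummationFilter.unconditional_filter,
    (schwartz_withSeminorms ℝ E F).tendsto_nhds]
  rintro ⟨k, n⟩ ε hε
  filter_upwards [(tendsto_tsum_compl_atTop_zero
    fun i => SchwartzMap.seminorm ℝ k n (g i)).eventually (gt_mem_nhds hε)] with s hs
  obtain ⟨V, hV, hV'⟩ := exists_schwartz_eq_tsum (fun i : {i // i ∉ s} => g i)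
    fun k n => (h k n).subtype _
  have e : ∑ i ∈ s, g i - U = -V := by
    ext x
    have hx : Summable fun i => g i x := Summable.of_norm
      ((h 0 0).of_nonneg_of_le (fun _ => norm_nonneg _) fun i => SchwartzMap.norm_le_seminorm ℝ _ x)
    have := hx.sum_add_tsum_subtype_compl s
    have e1 : (∑ i ∈ s, g i) x = ∑ i ∈ s, g i x := by
      induction s using Finset.cons_induction <;> simp_all
    rw [sub_apply, neg_apply, hU, hV, ← this, e1]
    abel
  rw [e, map_neg_eq_map]
  exact (hV' k n).trans_lt hs

theorem seminorm_translate_le (k n : ℕ) (y : E) (g : 𝓢(E, ℂ)) :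
    SchwartzMap.seminorm ℝ k n (SchwartzMap.compSubConstCLM ℂ y g) ≤
      2 ^ (k - 1) * (SchwartzMap.seminorm ℝ k n g + ‖y‖ ^ k * SchwartzMap.seminorm ℝ 0 n g) := by
  refine SchwartzMap.seminorm_le_bound ℝ k n _ (by positivity) fun x => ?_
  have e : iteratedFDeriv ℝ n (SchwartzMap.compSubConstCLM ℂ y g) x =
      iteratedFDeriv ℝ n g (x - y) := iteratedFDeriv_comp_sub n y x
  have h1 : ‖x‖ ^ k ≤ 2 ^ (k - 1) * (‖x - y‖ ^ k + ‖y‖ ^ k) := by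
    refine le_trans ?_ (add_pow_le (norm_nonneg _) (norm_nonneg _) k)
    gcongr
    simpa using norm_add_le (x - y) y
  have h2 := SchwartzMap.le_seminorm ℝ k n g (x - y)
  have h3 := SchwartzMap.norm_iteratedFDeriv_le_seminorm ℝ g n (x - y)
  rw [e]
  calc _ ≤ 2 ^ (k - 1) * (‖x - y‖ ^ k + ‖y‖ ^ k) * ‖iteratedFDeriv ℝ n g (x - y)‖ := by gcongr
    _ = 2 ^ (k - 1) * (‖x - y‖ ^ k * ‖iteratedFDeriv ℝ n g (x - y)‖ +
        ‖y‖ ^ k * ‖iteratedFDeriv ℝ n g (x - y)‖) := by ring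
    _ ≤ _ := by gcongr

end SchwartzSeries

theorem summable_one_add_sq {L : ℝ} (hL : 0 < L) :
    Summable fun k : ℤ => (1 + ((k : ℝ) / L) ^ 2)⁻¹ := by
  have h : Summable fun k : ℤ => L ^ 2 * (1 / (k : ℝ) ^ 2) :=
    (Real.summable_one_div_int_pow.2 one_lt_two).mul_left _
  refine h.of_norm_bounded_eventually ?_
  filter_upwards [(Set.finite_singleton (0 : ℤ)).compl_mem_cofinite] with k hk
  have hk : (k : ℝ) ≠ 0 := by exact_mod_cast hk
  have : 0 < (k : ℝ) ^ 2 := by positivity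
  have e : L ^ 2 * (1 + ((k : ℝ) / L) ^ 2) = L ^ 2 + k ^ 2 := by field_simp
  rw [Real.norm_of_nonneg (by positivity), mul_one_div, inv_eq_one_div,
    div_le_div_iff₀ (by positivity) this, e, one_mul]
  linarith [sq_nonneg L]

/-- The point of the lattice `L₁⁻¹ ℤ × L₂⁻¹ ℤ` of index `k`. -/
def latticePoint (L₁ L₂ : ℝ) (k : ℤ × ℤ) : Plane := WithLp.toLp 2 ![k.1 / L₁, k.2 / L₂]

theorem summable_latticePoint {L₁ L₂ : ℝ} (hL₁ : 0 < L₁) (hL₂ : 0 < L₂) (w : 𝓢(Plane, ℂ)) (n : ℕ) :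
    Summable fun k : ℤ × ℤ => ‖w (-latticePoint L₁ L₂ k)‖ * ‖latticePoint L₁ L₂ k‖ ^ n := by
  set C := 2 ^ (n + 4) * ((Finset.Iic (n + 4, 0)).sup fun m => SchwartzMap.seminorm ℝ m.1 m.2) w
  have hs := ((summable_one_add_sq hL₁).mul_of_nonneg (summable_one_add_sq hL₂)
    (fun _ => by positivity) (fun _ => by positivity)).mul_left C
  refine hs.of_nonneg_of_le (fun _ => by positivity) fun k => ?_
  set y := latticePoint L₁ L₂ k
  have h := SchwartzMap.one_add_le_sup_seminorm_apply (𝕜 := ℝ) (m := (n + 4, 0))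
    le_rfl le_rfl w (-y)
  rw [norm_iteratedFDeriv_zero, norm_neg] at h
  have h0 : |(k.1 : ℝ) / L₁| ≤ ‖y‖ := PiLp.norm_apply_le y 0
  have h1 : |(k.2 : ℝ) / L₂| ≤ ‖y‖ := PiLp.norm_apply_le y 1
  have h0' := sq_le_sq' (by linarith [abs_nonneg ((k.1 : ℝ) / L₁), norm_nonneg y]) h0
  have h1' := sq_le_sq' (by linarith [abs_nonneg ((k.2 : ℝ) / L₂), norm_nonneg y]) h1
  rw [sq_abs] at h0' h1'
  have hy := norm_nonneg y
  rw [← mul_inv, ← div_eq_mul_inv, le_div_iff₀ (by positivity)]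
  refine le_trans ?_ h
  have ha : 1 + ((k.1 : ℝ) / L₁) ^ 2 ≤ (1 + ‖y‖) ^ 2 := by nlinarith
  have hb : 1 + ((k.2 : ℝ) / L₂) ^ 2 ≤ (1 + ‖y‖) ^ 2 := by nlinarith
  have hc : ‖y‖ ^ n ≤ (1 + ‖y‖) ^ n := by gcongr; linarith
  calc _ ≤ ‖w (-y)‖ * (1 + ‖y‖) ^ n * ((1 + ‖y‖) ^ 2 * (1 + ‖y‖) ^ 2) := by gcongr
    _ = _ := by ring

/-- Series of translates along a lattice, with coefficients the samples of a Schwartz function,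
converge in the Schwartz space. -/
theorem summable_smul_translate {L₁ L₂ : ℝ} (hL₁ : 0 < L₁) (hL₂ : 0 < L₂) (w g : 𝓢(Plane, ℂ)) :
    Summable fun k : ℤ × ℤ => w (-latticePoint L₁ L₂ k) •
      SchwartzMap.compSubConstCLM ℂ (latticePoint L₁ L₂ k) g := by
  refine schwartz_summable _ fun p n => ?_
  have h0 := summable_latticePoint hL₁ hL₂ w 0
  have hp := summable_latticePoint hL₁ hL₂ w p
  refine ((h0.mul_right (2 ^ (p - 1) * SchwartzMap.seminorm ℝ p n g)).add
    (hp.mul_right (2 ^ (p - 1) * SchwartzMap.seminorm ℝ 0 n g))).of_nonneg_of_le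
    (fun _ => apply_nonneg _ _) fun k => ?_
  have e : ∀ (c : ℂ) (u : 𝓢(Plane, ℂ)),
      SchwartzMap.seminorm ℝ p n (c • u) = ‖c‖ * SchwartzMap.seminorm ℝ p n u := fun c u =>
    map_smul_eq_mul (SchwartzMap.seminorm ℂ p n) c u
  rw [e]
  refine (mul_le_mul_of_nonneg_left (seminorm_translate_le p n _ g) (norm_nonneg _)).trans_eq ?_
  ring

/-! ### Fourier transforms of the wavelets -/

/-- The identification of the plane with `ℝ × ℝ`. -/
def planeEquiv : Plane ≃ᵐ ℝ × ℝ :=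
  (MeasurableEquiv.toLp 2 (Fin 2 → ℝ)).symm.trans MeasurableEquiv.finTwoArrow

theorem measurePreserving_planeEquiv : MeasurePreserving planeEquiv :=
  (volume_preserving_finTwoArrow ℝ).comp
    (EuclideanSpace.volume_preserving_symm_measurableEquiv_toLp (Fin 2))

theorem planeEquiv_apply (x : Plane) : planeEquiv x = (x 0, x 1) := rfl

theorem planeEquiv_symm_apply (p : ℝ × ℝ) :
    planeEquiv.symm p = (WithLp.toLp 2 ![p.1, p.2] : Plane) := by
  rw [MeasurableEquiv.symm_apply_eq]; rfl

theorem integral_plane {f : Plane → ℂ} (hf : Integrable f) :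
    ∫ x, f x = ∫ s, ∫ t, f (WithLp.toLp 2 ![s, t]) := by
  have h1 := measurePreserving_planeEquiv.integral_comp' (fun p => f (planeEquiv.symm p))
  simp only [MeasurableEquiv.symm_apply_apply] at h1
  have h2 : Integrable (fun p => f (planeEquiv.symm p)) (volume : Measure (ℝ × ℝ)) :=
    ((measurePreserving_planeEquiv.symm).integrable_comp_emb
      planeEquiv.symm.measurableEmbedding).2 hf
  rw [h1, Measure.volume_eq_prod, integral_prod _ h2]
  simp only [planeEquiv_symm_apply]

theorem integral_plane_mul (g h : ℝ → ℂ) :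
    ∫ x : Plane, g (x 0) * h (x 1) = (∫ s, g s) * ∫ t, h t := by
  have h1 := measurePreserving_planeEquiv.integral_comp' (fun p => g p.1 * h p.2)
  simp only [planeEquiv_apply] at h1
  rw [h1, Measure.volume_eq_prod, integral_prod_mul]

theorem inner_plane (x y : Plane) : inner ℝ x y = x 0 * y 0 + x 1 * y 1 := by
  simp [PiLp.inner_apply, Fin.sum_univ_two, mul_comm]

theorem fourier_line_apply (g : ℝ → ℂ) (η : ℝ) : 𝓕 g η = ∫ x, chi (-(x * η)) * g x := by
  rw [Real.fourier_real_eq]; rfl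

theorem fourier_plane_apply (g : Plane → ℂ) (η : Plane) :
    𝓕 g η = ∫ x : Plane, chi (-(x 0 * η 0)) * chi (-(x 1 * η 1)) * g x := by
  rw [Real.fourier_eq]
  refine integral_congr_ae (Filter.Eventually.of_forall fun x => ?_)
  have : -(inner ℝ x η) = -(x 0 * η 0) + -(x 1 * η 1) := by rw [inner_plane]; ring
  simp only [this]
  rw [← chi_add]; rfl

theorem fourier_tensor (g h : 𝓢(ℝ, ℂ)) (η : Plane) :
    𝓕 (tensor g h) η = 𝓕 g (η 0) * 𝓕 h (η 1) := by
  rw [SchwartzMap.fourier_coe, SchwartzMap.fourier_coe, SchwartzMap.fourier_coe,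
    fourier_plane_apply, fourier_line_apply, fourier_line_apply, ← integral_plane_mul]
  refine integral_congr_ae (Filter.Eventually.of_forall fun x => ?_)
  change _ * (g (x 0) * h (x 1)) = _
  ring

theorem fourier_dilateTranslate (g : 𝓢(ℝ, ℂ)) (j k : ℤ) (η : ℝ) :
    𝓕 (dilateTranslate g j k) η = (((2 : ℝ) ^ j : ℝ) : ℂ)⁻¹ * chi (-(k / (2 : ℝ) ^ j * η)) *
      𝓕 g (η / (2 : ℝ) ^ j) := by
  have hL : (0 : ℝ) < (2 : ℝ) ^ j := by positivity
  rw [SchwartzMap.fourier_coe, SchwartzMap.fourier_coe, fourier_line_apply, fourier_line_apply]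
  simp only [dilateTranslate_apply]
  generalize (2 : ℝ) ^ j = L at *
  have h := Measure.integral_comp_mul_left
    (fun y => (fun y => chi (-((y + k) / L * η)) * g y) (y - k)) L
  rw [integral_sub_right_eq_self (fun y => chi (-((y + k) / L * η)) * g y) (k : ℝ),
    abs_of_pos (inv_pos.2 hL), Complex.real_smul, Complex.ofReal_inv] at h
  have e : ∀ x : ℝ, chi (-(x * η)) * g (L * x - k) =
      chi (-((L * x - k + k) / L * η)) * g (L * x - k) := fun x => by
    congr 3; field_simp; ring
  simp only [e]
  have e' : ∀ y : ℝ, chi (-((y + k) / L * η)) * g y =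
      chi (-(k / L * η)) * (chi (-(y * (η / L))) * g y) := fun y => by
    rw [← mul_assoc, ← chi_add]; congr 2; ring
  rw [h]
  simp only [e', integral_const_mul]
  ring

theorem fourier_wavelet (m : MeyerProfile) (η : ℝ) :
    𝓕 m.wavelet η = m.waveletHat (2 * Real.pi * η) := by
  rw [MeyerProfile.wavelet, fourier_fourierInv_eq]; rfl

theorem fourier_scaling (m : MeyerProfile) (η : ℝ) :
    𝓕 m.scaling η = m.scalingHat (2 * Real.pi * η) := by
  rw [MeyerProfile.scaling, fourier_fourierInv_eq]; rfl

theorem fourier_wavelet1D (m : MeyerProfile) {j : ℤ} (hj : -1 ≤ j) (k : ℤ) (η : ℝ) :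
    𝓕 (wavelet1D m j k) η = ((scale j : ℝ) : ℂ)⁻¹ * chi (-(k / scale j * η)) * m.freq j η := by
  by_cases h : j = -1
  · subst h
    rw [wavelet1D, if_pos rfl, fourier_dilateTranslate, fourier_scaling]
    simp [scale, MeyerProfile.freq]
  · have h0 : scale j = (2 : ℝ) ^ j := by rw [scale, max_eq_left (by omega)]
    rw [wavelet1D, if_neg h, fourier_dilateTranslate, fourier_wavelet, MeyerProfile.freq, if_neg h,
      h0]

theorem continuous_line (v : 𝓢(Plane, ℂ)) :
    Continuous (Function.uncurry fun s t : ℝ => v (WithLp.toLp 2 ![s, t])) := by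
  refine v.continuous.comp ((PiLp.continuous_toLp 2 _).comp (continuous_pi fun i => ?_))
  fin_cases i
  · exact continuous_fst
  · exact continuous_snd

/-- Samples of the Fourier transform at lattice points, as iterated integrals. -/
theorem fourier_latticePoint (v : 𝓢(Plane, ℂ)) (L₁ L₂ : ℝ) (k : ℤ × ℤ) :
    𝓕 v (latticePoint L₁ L₂ k) =
      latticeFourier (fun s t => v (WithLp.toLp 2 ![s, t])) L₁ L₂ k := by
  rw [SchwartzMap.fourier_coe, fourier_plane_apply, integral_plane]
  · rw [latticeFourier]
    refine integral_congr_ae (Filter.Eventually.of_forall fun s => ?_)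
    simp only [← integral_const_mul]
    refine integral_congr_ae (Filter.Eventually.of_forall fun t => ?_)
    simp [latticePoint, mul_comm s, mul_comm t, mul_assoc]
  · refine Integrable.bdd_mul (c := 1) v.integrable ?_ (Filter.Eventually.of_forall fun x => ?_)
    · refine Continuous.aestronglyMeasurable (Continuous.mul ?_ ?_) <;>
        exact continuous_chi.comp (by fun_prop)
    · simp

/-! ### Reconstruction of band-limited functions -/

/-- The hyperbolic wavelets, normalized in `L²`. -/
def unitWavelet (m : MeyerProfile) (l k : ℤ × ℤ) : 𝓢(Plane, ℂ) :=
  ((√(scale l.1 * scale l.2) : ℝ) : ℂ) • hyperbolicWavelet m l k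

theorem hyperbolicWavelet_eq_translate (m : MeyerProfile) {l : ℤ × ℤ} (k : ℤ × ℤ)
    (h₁ : -1 ≤ l.1) (h₂ : -1 ≤ l.2) : hyperbolicWavelet m l k =
      SchwartzMap.compSubConstCLM ℂ (latticePoint (scale l.1) (scale l.2) k)
        (hyperbolicWavelet m l 0) := by
  have key : ∀ {j : ℤ} (_ : -1 ≤ j) (k : ℤ) (x : ℝ),
      wavelet1D m j k x = wavelet1D m j 0 (x - k / scale j) := by
    intro j hj k x
    by_cases h : j = -1
    · simp [wavelet1D, h, dilateTranslate_apply, scale]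
    · have h0 : scale j = (2 : ℝ) ^ j := by rw [scale, max_eq_left (by omega)]
      have h1 : (2 : ℝ) ^ j ≠ 0 := by positivity
      rw [wavelet1D, if_neg h, wavelet1D, if_neg h, dilateTranslate_apply, dilateTranslate_apply,
        h0, mul_sub, mul_div_cancel₀ _ h1]
      simp
  ext x
  change wavelet1D m l.1 k.1 (x 0) * wavelet1D m l.2 k.2 (x 1) = _
  rw [key h₁, key h₂]
  rfl

theorem fourier_hyperbolicWavelet (m : MeyerProfile) {l : ℤ × ℤ} (k : ℤ × ℤ)
    (h₁ : -1 ≤ l.1) (h₂ : -1 ≤ l.2) (η : Plane) : 𝓕 (hyperbolicWavelet m l k) η =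
      ((scale l.1 : ℂ) * scale l.2)⁻¹ *
        (chi (-(k.1 / scale l.1 * η 0)) * chi (-(k.2 / scale l.2 * η 1))) *
          (m.freq l.1 (η 0) * m.freq l.2 (η 1)) := by
  rw [hyperbolicWavelet, fourier_tensor, fourier_wavelet1D m h₁, fourier_wavelet1D m h₂, mul_inv]
  ring

/-- The Schwartz function `ḡ h`. -/
def conjMul (g h : 𝓢(Plane, ℂ)) : 𝓢(Plane, ℂ) :=
  SchwartzMap.pairing (ContinuousLinearMap.mul ℝ ℂ)
    (SchwartzMap.postcompCLM (𝕜 := ℝ) (Complex.conjCLE : ℂ →L[ℝ] ℂ) g) h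

theorem conjMul_apply (g h : 𝓢(Plane, ℂ)) (x : Plane) :
    conjMul g h x = (starRingEnd ℂ) (g x) * h x := rfl

theorem chi_zero : chi 0 = 1 := by simp [chi]

theorem hasSum_apply {ι : Type*} (f : 𝓢'(Plane, ℂ)) {g : ι → 𝓢(Plane, ℂ)} {U : 𝓢(Plane, ℂ)}
    (h : HasSum g U) : HasSum (fun i => f (g i)) (f U) :=
  h.map f (map_continuous f)

theorem inner_hyperbolicWavelet (m : MeyerProfile) {l : ℤ × ℤ} (k : ℤ × ℤ)
    (h₁ : -1 ≤ l.1) (h₂ : -1 ≤ l.2) (h : 𝓢(Plane, ℂ)) :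
    inner ℂ ((hyperbolicWavelet m l k).toLp 2) (h.toLp 2) =
      𝓕 (conjMul (𝓕 (hyperbolicWavelet m l 0)) (𝓕 h))
        (-latticePoint (scale l.1) (scale l.2) k) := by
  rw [← SchwartzMap.inner_fourier_toL2_eq, SchwartzMap.inner_toL2_toL2_eq _ _ volume,
    SchwartzMap.fourier_coe (conjMul _ _), fourier_plane_apply]
  refine integral_congr_ae (Filter.Eventually.of_forall fun x => ?_)
  simp only [RCLike.inner_apply, conjMul_apply, fourier_hyperbolicWavelet m _ h₁ h₂, map_mul,
    conj_chi, neg_neg]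
  have e0 : -(x 0 * (-latticePoint (scale l.1) (scale l.2) k) 0) = k.1 / scale l.1 * x 0 := by
    simp [latticePoint, mul_comm]
  have e1 : -(x 1 * (-latticePoint (scale l.1) (scale l.2) k) 1) = k.2 / scale l.2 * x 1 := by
    simp [latticePoint, mul_comm]
  rw [e0, e1]
  simp [chi_zero]
  ring

theorem scale_mul_pos (l : ℤ × ℤ) : 0 < scale l.1 * scale l.2 :=
  mul_pos (scale_pos _) (scale_pos _)

theorem ofReal_sqrt_mul_self (l : ℤ × ℤ) :
    ((√(scale l.1 * scale l.2) : ℝ) : ℂ) * ((√(scale l.1 * scale l.2) : ℝ) : ℂ) =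
      (scale l.1 : ℂ) * scale l.2 := by
  rw [← Complex.ofReal_mul, Real.mul_self_sqrt (scale_mul_pos l).le, Complex.ofReal_mul]

theorem inner_smul_unitWavelet (m : MeyerProfile) (l k : ℤ × ℤ) (h : 𝓢(Plane, ℂ)) :
    inner ℂ ((unitWavelet m l k).toLp 2) (h.toLp 2) • unitWavelet m l k =
      ((scale l.1 : ℂ) * scale l.2) •
        (inner ℂ ((hyperbolicWavelet m l k).toLp 2) (h.toLp 2) • hyperbolicWavelet m l k) := by
  have e : (unitWavelet m l k).toLp 2 = ((√(scale l.1 * scale l.2) : ℝ) : ℂ) •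
      (hyperbolicWavelet m l k).toLp 2 :=
    map_smul (SchwartzMap.toLpCLM ℂ ℂ 2 (volume : Measure Plane)) _ _
  rw [e, inner_smul_left, Complex.conj_ofReal, unitWavelet, smul_smul, smul_smul,
    ← ofReal_sqrt_mul_self]
  congr 1; ring

theorem summable_reconstruction (m : MeyerProfile) {l : ℤ × ℤ}
    (h₁ : -1 ≤ l.1) (h₂ : -1 ≤ l.2) (h : 𝓢(Plane, ℂ)) : Summable fun k : ℤ × ℤ =>
      inner ℂ ((unitWavelet m l k).toLp 2) (h.toLp 2) • unitWavelet m l k := by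
  simp only [inner_smul_unitWavelet]
  refine Summable.const_smul _ ?_
  simp only [inner_hyperbolicWavelet m _ h₁ h₂]
  have := summable_smul_translate (scale_pos l.1) (scale_pos l.2)
    (𝓕 (conjMul (𝓕 (hyperbolicWavelet m l 0)) (𝓕 h))) (hyperbolicWavelet m l 0)
  refine this.congr fun k => ?_
  rw [hyperbolicWavelet_eq_translate m k h₁ h₂]

/-- By Poisson summation, the component of index `l` of a band-limited function is, in frequency,
its periodized product with the profiles of index `l`. -/
theorem fourier_component (m : MeyerProfile) {l : ℤ × ℤ} (h₁ : -1 ≤ l.1) (h₂ : -1 ≤ l.2)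
    (h : 𝓢(Plane, ℂ)) {R : ℝ} (hR : ∀ η : Plane, (∃ i, R < |η i|) → 𝓕 h η = 0) (η : Plane) :
    𝓕 (∑' k : ℤ × ℤ, inner ℂ ((unitWavelet m l k).toLp 2) (h.toLp 2) • unitWavelet m l k) η =
      foldProd (m.freq l.2) (scale l.2) (fun t => foldProd (m.freq l.1) (scale l.1)
        (fun s => 𝓕 h (WithLp.toLp 2 ![s, t])) (η 0)) (η 1) := by
  set v := conjMul (𝓕 (hyperbolicWavelet m l 0)) (𝓕 h) with hv
  have hL₁ := scale_pos l.1
  have hL₂ := scale_pos l.2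
  have hb : ∀ x : Plane, v x = ((scale l.1 : ℂ) * scale l.2)⁻¹ *
      ((starRingEnd ℂ) (m.freq l.1 (x 0)) * (starRingEnd ℂ) (m.freq l.2 (x 1)) * 𝓕 h x) := by
    intro x
    rw [hv, conjMul_apply, fourier_hyperbolicWavelet m _ h₁ h₂]
    simp [chi_zero]
    ring
  have hL : ((scale l.1 : ℂ) * scale l.2) ≠ 0 := by exact_mod_cast (scale_mul_pos l).ne'
  have hc₁ : (scale l.1 : ℂ) ≠ 0 := left_ne_zero_of_mul hL
  have hc₂ : (scale l.2 : ℂ) ≠ 0 := right_ne_zero_of_mul hL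
  -- Evaluation of the Fourier transform at `η`, as a tempered distribution.
  have hs := (hasSum_apply (𝓕 (TemperedDistribution.delta η))
    (summable_reconstruction m h₁ h₂ h).hasSum).tsum_eq
  simp only [TemperedDistribution.fourier_apply, TemperedDistribution.delta_apply] at hs
  let A : ℤ × ℤ → ℂ := fun k => chi (k.1 / scale l.1 * η 0) * chi (k.2 / scale l.2 * η 1) *
    latticeFourier (fun s t => v (WithLp.toLp 2 ![s, t])) (scale l.1) (scale l.2) k
  have hterm : ∀ k : ℤ × ℤ,
      𝓕 (inner ℂ ((unitWavelet m l k).toLp 2) (h.toLp 2) • unitWavelet m l k) η =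
        m.freq l.1 (η 0) * m.freq l.2 (η 1) * A (-k) := by
    intro k
    simp only [A]
    have hneg : -latticePoint (scale l.1) (scale l.2) k =
        latticePoint (scale l.1) (scale l.2) (-k) := by
      ext i; fin_cases i <;> simp [latticePoint, neg_div]
    rw [inner_smul_unitWavelet, inner_hyperbolicWavelet m k h₁ h₂, hneg, fourier_latticePoint,
      fourier_smul, fourier_smul, smul_apply, smul_apply,
      fourier_hyperbolicWavelet m k h₁ h₂, smul_eq_mul, smul_eq_mul]
    have e0 : (((-k).1 : ℤ) : ℝ) / scale l.1 * η 0 = -(k.1 / scale l.1 * η 0) := by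
      simp; ring
    have e1 : (((-k).2 : ℤ) : ℝ) / scale l.2 * η 1 = -(k.2 / scale l.2 * η 1) := by
      simp; ring
    rw [e0, e1, ← hv]
    generalize latticeFourier (fun s t => v (WithLp.toLp 2 ![s, t])) (scale l.1) (scale l.2) (-k) = a
    generalize chi (-(k.1 / scale l.1 * η 0)) = c₁
    generalize chi (-(k.2 / scale l.2 * η 1)) = c₂
    linear_combination a * c₁ * c₂ * m.freq l.1 (η 0) * m.freq l.2 (η 1) * mul_inv_cancel₀ hL
  have hsum : Summable
      (latticeFourier (fun s t => v (WithLp.toLp 2 ![s, t])) (scale l.1) (scale l.2)) := by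
    have := summable_latticePoint hL₁ hL₂ (𝓕 v) 0
    simp only [pow_zero, mul_one] at this
    have h' := (Equiv.neg (ℤ × ℤ)).summable_iff.2 this
    refine Summable.of_norm (h'.congr fun k => ?_)
    have hneg : -latticePoint (scale l.1) (scale l.2) (-k) =
        latticePoint (scale l.1) (scale l.2) k := by
      ext i; fin_cases i <;> simp [latticePoint, neg_div]
    simp only [Function.comp_apply, Equiv.neg_apply, hneg, fourier_latticePoint]
  have hP := poisson_plane (R := R) (continuous_line v)
    (fun s t hs => by simp only [hb]; rw [hR _ ⟨0, hs⟩]; simp)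
    (fun s t ht => by simp only [hb]; rw [hR _ ⟨1, ht⟩]; simp) hL₁ hL₂ hsum (η 0) (η 1)
  rw [← hs]
  simp only [hterm]
  have hA : ∑' k, A (-k) = ∑' k, A k := (Equiv.neg (ℤ × ℤ)).tsum_eq A
  rw [tsum_mul_left, hA]
  rw [eq_inv_mul_iff_mul_eq₀ hL] at hP
  rw [show ∑' k, A k = _ from hP.symm]
  simp only [hb, foldProd, ← tsum_mul_left]
  refine tsum_congr fun n₂ => tsum_congr fun n₁ => ?_
  simp
  field_simp

theorem foldProd_sum {ι : Type*} (s : Finset ι) {b : ℝ → ℂ} {L R : ℝ} (hL : 0 < L)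
    {u : ι → ℝ → ℂ} (hu : ∀ i t, R < |t| → u i t = 0) (η : ℝ) :
    ∑ i ∈ s, foldProd b L (u i) η = foldProd b L (fun t => ∑ i ∈ s, u i t) η := by
  simp only [foldProd, Finset.mul_sum]
  rw [Summable.tsum_finsetSum fun i _ => summable_shift hL (hu i) η _, Finset.mul_sum]

/-- The indices of the wavelets needed for the frequencies of the box `|ηᵢ| ≤ 2 ^ J / 3`. -/
def indexBox (J : ℕ) : Finset (ℤ × ℤ) := Finset.Ico (-1 : ℤ) J ×ˢ Finset.Ico (-1 : ℤ) J

theorem neg_one_le_of_mem_indexBox {J : ℕ} {l : ℤ × ℤ} (hl : l ∈ indexBox J) :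
    -1 ≤ l.1 ∧ -1 ≤ l.2 := by
  simp only [indexBox, Finset.mem_product, Finset.mem_Ico] at hl
  exact ⟨hl.1.1, hl.2.1⟩

/-- A band-limited Schwartz function is the sum, in the Schwartz space, of its wavelet series. -/
theorem sum_components (m : MeyerProfile) {J : ℕ} {h : 𝓢(Plane, ℂ)}
    (hJ : ∀ η : Plane, (∃ i, (2 : ℝ) ^ J / 3 < |η i|) → 𝓕 h η = 0) :
    ∑ l ∈ indexBox J, ∑' k : ℤ × ℤ,
      inner ℂ ((unitWavelet m l k).toLp 2) (h.toLp 2) • unitWavelet m l k = h := by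
  refine (FourierTransform.fourierCLE ℂ 𝓢(Plane, ℂ)).injective ?_
  simp only [FourierTransform.fourierCLE_apply]
  ext η
  have e : 𝓕 (∑ l ∈ indexBox J, ∑' k : ℤ × ℤ,
      inner ℂ ((unitWavelet m l k).toLp 2) (h.toLp 2) • unitWavelet m l k) η =
      ∑ l ∈ indexBox J, 𝓕 (∑' k : ℤ × ℤ,
        inner ℂ ((unitWavelet m l k).toLp 2) (h.toLp 2) • unitWavelet m l k) η :=
    map_sum (𝓕 (TemperedDistribution.delta η)) _ _
  rw [e, Finset.sum_congr rfl fun l hl => fourier_component m (neg_one_le_of_mem_indexBox hl).1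
    (neg_one_le_of_mem_indexBox hl).2 h hJ η, indexBox, Finset.sum_product_right]
  have hz : ∀ (j : ℤ) (t : ℝ), (2 : ℝ) ^ J / 3 < |t| → foldProd (m.freq j) (scale j)
      (fun s => 𝓕 h (WithLp.toLp 2 ![s, t])) (η 0) = 0 := by
    intro j t ht
    have : ∀ s : ℝ, 𝓕 h (WithLp.toLp 2 ![s, t]) = 0 := fun s => hJ _ ⟨1, ht⟩
    simp [foldProd, this]
  have h1 : ∀ t, ∑ j ∈ Finset.Ico (-1 : ℤ) J, foldProd (m.freq j) (scale j)
      (fun s => 𝓕 h (WithLp.toLp 2 ![s, t])) (η 0) = 𝓕 h (WithLp.toLp 2 ![η 0, t]) := fun t =>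
    m.sum_foldProd_freq (fun s hs => hJ _ ⟨0, hs⟩) (η 0)
  simp only
  rw [Finset.sum_congr rfl fun j _ => foldProd_sum _ (scale_pos j) hz (η 1)]
  simp only [h1]
  rw [m.sum_foldProd_freq (fun t ht => hJ _ ⟨1, ht⟩) (η 1)]
  congr 1
  ext i; fin_cases i <;> rfl

theorem hasSum_wavelet (m : MeyerProfile) {J : ℕ} {h : 𝓢(Plane, ℂ)}
    (hJ : ∀ η : Plane, (∃ i, (2 : ℝ) ^ J / 3 < |η i|) → 𝓕 h η = 0) (f : 𝓢'(Plane, ℂ)) :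
    (∀ l ∈ indexBox J, Summable fun k : ℤ × ℤ =>
      inner ℂ ((unitWavelet m l k).toLp 2) (h.toLp 2) * f (unitWavelet m l k)) ∧
    f h = ∑ l ∈ indexBox J, ∑' k : ℤ × ℤ,
      inner ℂ ((unitWavelet m l k).toLp 2) (h.toLp 2) * f (unitWavelet m l k) := by
  have hs : ∀ l ∈ indexBox J, HasSum (fun k : ℤ × ℤ =>
      inner ℂ ((unitWavelet m l k).toLp 2) (h.toLp 2) * f (unitWavelet m l k))
      (f (∑' k : ℤ × ℤ, inner ℂ ((unitWavelet m l k).toLp 2) (h.toLp 2) • unitWavelet m l k)) := by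
    intro l hl
    obtain ⟨h₁, h₂⟩ := neg_one_le_of_mem_indexBox hl
    have := hasSum_apply f (summable_reconstruction m h₁ h₂ h).hasSum
    simpa only [map_smul, smul_eq_mul] using this
  refine ⟨fun l hl => (hs l hl).summable, ?_⟩
  conv_lhs => rw [← sum_components m hJ, map_sum]
  exact Finset.sum_congr rfl fun l hl => (hs l hl).tsum_eq.symm

/-- Parseval's identity for the wavelet coefficients of a band-limited function. -/
theorem parseval_wavelet (m : MeyerProfile) {J : ℕ} {h : 𝓢(Plane, ℂ)}
    (hJ : ∀ η : Plane, (∃ i, (2 : ℝ) ^ J / 3 < |η i|) → 𝓕 h η = 0) :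
    (∀ l ∈ indexBox J, Summable fun k : ℤ × ℤ =>
      ‖(inner ℂ ((unitWavelet m l k).toLp 2) (h.toLp 2) : ℂ)‖ ^ 2) ∧
    ∑ l ∈ indexBox J, ∑' k : ℤ × ℤ,
      ‖(inner ℂ ((unitWavelet m l k).toLp 2) (h.toLp 2) : ℂ)‖ ^ 2 = ‖h.toLp 2‖ ^ 2 := by
  -- The wavelet series of `h`, tested against the functional `⟪h, ·⟫`.
  let T : 𝓢'(Plane, ℂ) := ContinuousLinearMap.toPointwiseConvergenceCLM _ _ _ _
    (innerSL ℂ (h.toLp 2) ∘L SchwartzMap.toLpCLM ℂ ℂ 2 (volume : Measure Plane))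
  have hT : ∀ g : 𝓢(Plane, ℂ), T g = inner ℂ (h.toLp 2) (g.toLp 2) := fun _ => rfl
  have hm : ∀ g : 𝓢(Plane, ℂ), inner ℂ (g.toLp 2) (h.toLp 2) * T g =
      ((‖(inner ℂ (g.toLp 2) (h.toLp 2) : ℂ)‖ ^ 2 : ℝ) : ℂ) := by
    intro g
    rw [hT, ← inner_conj_symm (𝕜 := ℂ) (h.toLp 2 volume) (g.toLp 2 volume),
      Complex.mul_conj, Complex.normSq_eq_norm_sq]
  obtain ⟨hs, he⟩ := hasSum_wavelet m hJ T
  simp only [hm] at hs he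
  refine ⟨fun l hl => Complex.summable_ofReal.1 (hs l hl), ?_⟩
  rw [hT, inner_self_eq_norm_sq_to_K] at he
  simp only [← Complex.ofReal_tsum, ← Complex.ofReal_sum] at he
  refine Complex.ofReal_injective (he.symm.trans ?_)
  simp

/-! ### The `L²` norm of a tempered distribution by duality -/

theorem toTemperedDistribution_star_apply (g : Lp ℂ 2 (volume : Measure Plane))
    (u : 𝓢(Plane, ℂ)) : Lp.toTemperedDistribution (star g) u = inner ℂ g (u.toLp 2) := by
  rw [Lp.toTemperedDistribution_apply, L2.inner_def]
  refine integral_congr_ae ?_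
  filter_upwards [Lp.coeFn_star g, u.coeFn_toLp 2 volume] with x h1 h2
  rw [h1, h2, smul_eq_mul, RCLike.inner_apply]
  rfl

theorem norm_star_Lp (g : Lp ℂ 2 (volume : Measure Plane)) : ‖star g‖ = ‖g‖ := by
  rw [Lp.norm_def, Lp.norm_def]
  congr 1
  refine eLpNorm_congr_norm_ae ?_
  filter_upwards [Lp.coeFn_star g] with x h
  rw [h, Pi.star_apply, norm_star]

/-- By the Riesz representation theorem, a distribution that is bounded for the `L²` norm is a
square integrable function. -/
theorem distL2Norm_le_of_bound {T : 𝓢'(Plane, ℂ)} {C : ℝ}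
    (hT : ∀ u : 𝓢(Plane, ℂ), ‖T u‖ ≤ C * ‖u.toLp 2‖) : distL2Norm T ≤ ENNReal.ofReal C := by
  set e : 𝓢(Plane, ℂ) →ₗ[ℂ] Lp ℂ 2 (volume : Measure Plane) :=
    (SchwartzMap.toLpCLM ℂ ℂ 2 (volume : Measure Plane)).toLinearMap
  have hd : DenseRange e :=
    SchwartzMap.denseRange_toLpCLM (E := Plane) (F := ℂ) (p := 2) ENNReal.ofNat_ne_top
  let T' : 𝓢(Plane, ℂ) →ₗ[ℂ] ℂ := { toFun := T, map_add' := map_add T, map_smul' := map_smul T }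
  set Λ : Lp ℂ 2 (volume : Measure Plane) →L[ℂ] ℂ := T'.extendOfNorm e
  have hΛ : ∀ u : 𝓢(Plane, ℂ), Λ (u.toLp 2) = T u := fun u =>
    LinearMap.extendOfNorm_eq hd ⟨C, hT⟩ u
  have hn : ∀ x, ‖Λ x‖ ≤ C * ‖x‖ := LinearMap.norm_extendOfNorm_apply_le hd C hT
  set g := (InnerProductSpace.toDual ℂ (Lp ℂ 2 (volume : Measure Plane))).symm Λ
  have hg : ∀ x, inner ℂ g x = Λ x := fun x => InnerProductSpace.toDual_symm_apply
  have hrep : Lp.toTemperedDistribution (star g) = T := by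
    ext u
    rw [toTemperedDistribution_star_apply, hg, hΛ]
  refine (iInf₂_le (star g) hrep).trans ?_
  rw [← ofReal_norm, norm_star_Lp]
  rcases eq_or_ne g 0 with h0 | h0
  · simp [h0]
  · refine ENNReal.ofReal_le_ofReal ?_
    have h := hn g
    rw [← hg, inner_self_eq_norm_sq_to_K, norm_pow, RCLike.norm_ofReal, abs_norm, sq] at h
    exact le_of_mul_le_mul_right h (norm_pos_iff.2 h0)

theorem norm_apply_le_distL2Norm {T : 𝓢'(Plane, ℂ)} (hT : distL2Norm T ≠ ⊤) (u : 𝓢(Plane, ℂ)) :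
    ‖T u‖ ≤ (distL2Norm T).toReal * ‖u.toLp 2‖ := by
  have key : ∀ g : Lp ℂ 2 (volume : Measure Plane), Lp.toTemperedDistribution g = T →
      ‖T u‖ ≤ ‖g‖ * ‖u.toLp 2‖ := by
    rintro g rfl
    rw [← star_star g, toTemperedDistribution_star_apply, norm_star_Lp (star g)]
    exact norm_inner_le_norm _ _
  rcases eq_or_ne (u.toLp 2) 0 with h0 | h0
  · have hu : u = 0 := SchwartzMap.injective_toLp 2 volume
      (h0.trans (map_zero (SchwartzMap.toLpCLM ℂ ℂ 2 (volume : Measure Plane))).symm)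
    rw [hu, map_zero, norm_zero]
    positivity
  · have hp := norm_pos_iff.2 h0
    rw [← div_le_iff₀ hp, ← ENNReal.ofReal_le_iff_le_toReal hT]
    refine le_iInf₂ fun g hg => ?_
    rw [← ofReal_norm]
    exact ENNReal.ofReal_le_ofReal ((div_le_iff₀ hp).2 (key g hg))

/-! ### Frequency supports and the index sets -/

/-- The cutoff of the anisotropic box `|ξᵢ| ≤ 2 ^ (r αᵢ)`. -/
def boxCutoff (α : Fin 2 → ℝ) (φ₀ : 𝓢(Plane, ℝ)) (r : ℝ) (ξ : Plane) : ℝ :=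
  φ₀ (anisoScale α ((2 : ℝ) ^ (-r)) ξ)

theorem abs_anisoScale (α : Fin 2 → ℝ) (r : ℝ) (ξ : Plane) (i : Fin 2) :
    |anisoScale α ((2 : ℝ) ^ (-r)) ξ i| = (2 : ℝ) ^ (-(r * α i)) * |ξ i| := by
  change |((2 : ℝ) ^ (-r)) ^ α i * ξ i| = _
  rw [← Real.rpow_mul zero_le_two, abs_mul, abs_of_pos (by positivity), neg_mul]

section Cutoff

variable {α : Fin 2 → ℝ} {φ₀ : 𝓢(Plane, ℝ)}

theorem boxCutoff_eq_one (hφ₀ : IsAnisoCutoff α φ₀) {r : ℝ} {ξ : Plane}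
    (h : ∀ i, |ξ i| ≤ (2 : ℝ) ^ (r * α i)) : boxCutoff α φ₀ r ξ = 1 := by
  refine hφ₀.eq_one _ fun i => ?_
  rw [abs_anisoScale, Real.rpow_neg zero_le_two, inv_mul_le_iff₀ (by positivity), mul_one]
  exact h i

theorem boxCutoff_eq_zero (hφ₀ : IsAnisoCutoff α φ₀) {r : ℝ} {ξ : Plane} {i : Fin 2}
    (h : (2 : ℝ) ^ ((r + 1) * α i) ≤ |ξ i|) : boxCutoff α φ₀ r ξ = 0 := by
  refine hφ₀.eq_zero _ ⟨i, ?_⟩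
  rw [abs_anisoScale, ← mul_assoc, ← Real.rpow_add two_pos]
  have : -α i + -(r * α i) = -((r + 1) * α i) := by ring
  rw [this, Real.rpow_neg zero_le_two, ← div_eq_inv_mul, one_le_div (by positivity)]
  exact h

theorem anisoResolution_zero (ξ : Plane) : anisoResolution α φ₀ 0 ξ = boxCutoff α φ₀ 0 ξ := by
  have : anisoScale α ((2 : ℝ) ^ (-(0 : ℝ))) ξ = ξ := by
    ext i; simp [anisoScale]
  rw [boxCutoff, this]; rfl

theorem anisoResolution_succ (j : ℕ) (ξ : Plane) : anisoResolution α φ₀ (j + 1) ξ =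
    boxCutoff α φ₀ (j + 1) ξ - boxCutoff α φ₀ j ξ := rfl

theorem sum_anisoResolution (N : ℕ) (ξ : Plane) :
    ∑ j ∈ Finset.range (N + 1), anisoResolution α φ₀ j ξ = boxCutoff α φ₀ N ξ := by
  induction N with
  | zero => simp [anisoResolution_zero]
  | succ N ih => rw [Finset.sum_range_succ, ih, anisoResolution_succ]; push_cast; ring

theorem anisoResolution_support (hα : IsAdmissible α) (hφ₀ : IsAnisoCutoff α φ₀) {j : ℕ} {ξ : Plane}
    (h : anisoResolution α φ₀ j ξ ≠ 0) :
    (∀ i, |ξ i| < (2 : ℝ) ^ (((j : ℝ) + 1) * α i)) ∧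
      (j ≠ 0 → ∃ i, (2 : ℝ) ^ (((j : ℝ) - 1) * α i) < |ξ i|) := by
  rcases j with _ | j
  · refine ⟨fun i => ?_, fun h0 => absurd rfl h0⟩
    by_contra hc
    refine h ?_
    rw [anisoResolution_zero]
    exact boxCutoff_eq_zero hφ₀ (i := i) (by simpa using hc)
  · rw [anisoResolution_succ] at h
    push_cast
    constructor
    · intro i
      by_contra hc
      have hc := not_lt.mp hc
      have hle : (2 : ℝ) ^ (((j : ℝ) + 1) * α i) ≤ (2 : ℝ) ^ (((j : ℝ) + 1 + 1) * α i) :=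
        Real.rpow_le_rpow_of_exponent_le one_le_two (by nlinarith [hα.pos i])
      exact h (by rw [boxCutoff_eq_zero hφ₀ hc, boxCutoff_eq_zero hφ₀ (hle.trans hc), sub_self])
    · intro _
      by_contra hc
      push Not at hc
      simp only [add_sub_cancel_right] at hc
      have hle : ∀ i, (2 : ℝ) ^ ((j : ℝ) * α i) ≤ (2 : ℝ) ^ (((j : ℝ) + 1) * α i) := fun i =>
        Real.rpow_le_rpow_of_exponent_le one_le_two (by nlinarith [hα.pos i])
      exact h (by rw [boxCutoff_eq_one hφ₀ hc, boxCutoff_eq_one hφ₀ fun i => (hc i).trans (hle i),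
        sub_self])

/-- A bound for all the functions of the resolution; `φ₀` itself may exceed `1`. -/
theorem exists_abs_anisoResolution_le (hφ₀ : IsAnisoCutoff α φ₀) :
    ∃ M : ℝ, 1 ≤ M ∧ ∀ j ξ, |anisoResolution α φ₀ j ξ| ≤ M := by
  set B := SchwartzMap.seminorm ℝ 0 0 φ₀
  have hB : ∀ r ξ, boxCutoff α φ₀ r ξ ≤ B := fun r ξ =>
    (le_abs_self _).trans (SchwartzMap.norm_le_seminorm ℝ φ₀ _)
  have h0 : ∀ r ξ, 0 ≤ boxCutoff α φ₀ r ξ := fun r ξ => hφ₀.nonneg _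
  have hB0 : 0 ≤ B := apply_nonneg _ _
  refine ⟨B + 1, by linarith, fun j ξ => ?_⟩
  rcases j with _ | j
  · rw [anisoResolution_zero, abs_of_nonneg (h0 _ _)]
    linarith [hB 0 ξ]
  · rw [anisoResolution_succ, abs_le]
    constructor <;> linarith [hB (j + 1) ξ, h0 (j + 1) ξ, hB j ξ, h0 j ξ]

theorem hasTemperateGrowth_anisoResolution (α : Fin 2 → ℝ) (φ₀ : 𝓢(Plane, ℝ)) (j : ℕ) :
    Function.HasTemperateGrowth
      fun η : Plane => ((anisoResolution α φ₀ j ((2 * Real.pi) • η) : ℝ) : ℂ) := by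
  have key : ∀ r : ℝ, Function.HasTemperateGrowth
      fun η : Plane => boxCutoff α φ₀ r ((2 * Real.pi) • η) := by
    intro r
    let A : Plane →ₗ[ℝ] Plane :=
      { toFun := fun η => anisoScale α ((2 : ℝ) ^ (-r)) ((2 * Real.pi) • η)
        map_add' := fun x y => by ext i; simp [anisoScale, mul_add]
        map_smul' := fun c x => by ext i; simp [anisoScale, mul_left_comm] }
    exact φ₀.hasTemperateGrowth.comp (LinearMap.toContinuousLinearMap A).hasTemperateGrowth
  refine Function.HasTemperateGrowth.comp (g := fun r : ℝ => (r : ℂ))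
    Complex.ofRealCLM.hasTemperateGrowth ?_
  rcases j with _ | j
  · simp only [anisoResolution_zero]
    exact key 0
  · simp only [anisoResolution_succ]
    exact (key (j + 1)).sub (key j)

end Cutoff

namespace MeyerProfile

theorem freq_support (m : MeyerProfile) {j : ℤ} (hj : -1 ≤ j) {t : ℝ} (h : m.freq j t ≠ 0) :
    |2 * Real.pi * t| < (2 : ℝ) ^ ((j : ℝ) + 4) ∧
      (j ≠ -1 → (2 : ℝ) ^ ((j : ℝ) + 1) < |2 * Real.pi * t|) := by
  have hpi := Real.pi_lt_four
  have hpi3 := Real.pi_gt_three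
  rw [freq] at h
  split_ifs at h with h0
  · refine ⟨?_, fun hc => absurd h0 hc⟩
    subst h0
    have : |2 * Real.pi * t| < 4 * Real.pi / 3 := by
      by_contra hc
      exact h (m.scalingHat_eq_zero (not_lt.mp hc))
    norm_num at this ⊢
    linarith
  · have hs : scale j = (2 : ℝ) ^ j := by rw [scale, max_eq_left (by omega)]
    have hp : (0 : ℝ) < (2 : ℝ) ^ j := by positivity
    rw [hs] at h
    have habs : |2 * Real.pi * (t / (2 : ℝ) ^ j)| = |2 * Real.pi * t| / (2 : ℝ) ^ j := by
      rw [← mul_div_assoc, abs_div, abs_of_pos hp]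
    have h4 : (2 : ℝ) ^ ((j : ℝ) + 4) = (2 : ℝ) ^ j * 16 := by
      rw [Real.rpow_add two_pos, Real.rpow_intCast]; norm_num
    have h1 : (2 : ℝ) ^ ((j : ℝ) + 1) = (2 : ℝ) ^ j * 2 := by
      rw [Real.rpow_add two_pos, Real.rpow_intCast]; norm_num
    have u1 : |2 * Real.pi * t| / (2 : ℝ) ^ j < 8 * Real.pi / 3 := by
      by_contra hc
      exact h (m.waveletHat_eq_zero (habs ▸ not_lt.mp hc))
    have u2 : 2 * Real.pi / 3 < |2 * Real.pi * t| / (2 : ℝ) ^ j := by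
      by_contra hc
      refine h ?_
      rw [waveletHat_two_pi, m.high_eq_zero]
      · simp
      · rw [← habs, abs_two_pi_mul] at hc
        have hc := not_lt.mp hc
        rw [mul_div_assoc, show (2 : ℝ) * (Real.pi / 3) = 2 * Real.pi * (1 / 3) by ring] at hc
        exact le_of_mul_le_mul_left hc Real.two_pi_pos
    rw [div_lt_iff₀ hp] at u1
    rw [lt_div_iff₀ hp] at u2
    rw [h4, h1]
    refine ⟨?_, fun _ => ?_⟩ <;> nlinarith

end MeyerProfile

section Indices

variable {α : Fin 2 → ℝ}

/-- Every index belongs to `Γⱼ(α)` for the smallest `j` such that `lᵢ ≤ [j αᵢ] + 1` for both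
`i`. -/
theorem exists_mem_Gam (hα : IsAdmissible α) {l : ℤ × ℤ} (h₁ : -1 ≤ l.1) (h₂ : -1 ≤ l.2) :
    ∃ j : ℕ, l ∈ Gam α j ∧ (l.1 ≤ ⌊j * α 0⌋ + 1 ∧ l.2 ≤ ⌊j * α 1⌋ + 1) ∧
      ∀ k : ℕ, l.1 ≤ ⌊k * α 0⌋ + 1 → l.2 ≤ ⌊k * α 1⌋ + 1 → j ≤ k := by
  classical
  have hex : ∃ j : ℕ, l.1 ≤ ⌊j * α 0⌋ + 1 ∧ l.2 ≤ ⌊j * α 1⌋ + 1 := by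
    have key : ∀ (a : ℝ) (_ : 0 < a) (z : ℤ), ∀ᶠ j : ℕ in Filter.atTop, z ≤ ⌊j * a⌋ + 1 := by
      intro a ha z
      filter_upwards [(tendsto_natCast_atTop_atTop.atTop_mul_const ha).eventually_ge_atTop (z : ℝ)]
        with j hj
      have := Int.le_floor.2 hj
      omega
    exact ((key _ (hα.pos 0) l.1).and (key _ (hα.pos 1) l.2)).exists
  obtain ⟨hj₁, hj₂⟩ := Nat.find_spec hex
  refine ⟨Nat.find hex, ?_, ⟨hj₁, hj₂⟩, fun k hk₁ hk₂ => Nat.find_min' hex ⟨hk₁, hk₂⟩⟩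
  rcases hj : Nat.find hex with _ | k
  · rw [hj] at hj₁ hj₂
    have neg : ∀ a : ℝ, 0 < a → ⌊(((0 : ℕ) : ℝ) - 1) * a⌋ ≤ 0 := fun a ha =>
      Int.floor_le_iff.2 (by push_cast; linarith)
    have n₁ := neg _ (hα.pos 0)
    have n₂ := neg _ (hα.pos 1)
    exact Or.inr ⟨⟨h₁, by omega, hj₁⟩, ⟨h₂, by omega, hj₂⟩⟩
  · have hk := Nat.find_min hex (m := k) (by omega)
    rw [hj] at hj₁ hj₂
    have e : ((k + 1 : ℕ) : ℝ) - 1 = k := by push_cast; ring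
    simp only [Gam, Set.mem_union, Set.mem_prod, highRange, lowRange, Set.mem_ofPred_eq, e]
    omega

theorem le_of_mem_Gam (hα : IsAdmissible α) {l : ℤ × ℤ} {j : ℕ} (hl : l ∈ Gam α j) :
    (-1 ≤ l.1 ∧ -1 ≤ l.2) ∧ (l.1 ≤ ⌊j * α 0⌋ + 1 ∧ l.2 ≤ ⌊j * α 1⌋ + 1) ∧
      (⌊((j : ℝ) - 1) * α 0⌋ - 1 ≤ l.1 ∨ ⌊((j : ℝ) - 1) * α 1⌋ - 1 ≤ l.2) := by
  have mono : ∀ i, ⌊((j : ℝ) - 1) * α i⌋ ≤ ⌊j * α i⌋ := fun i =>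
    Int.floor_le_floor (by nlinarith [hα.pos i])
  have m₀ := mono 0
  have m₁ := mono 1
  simp only [Gam, Set.mem_union, Set.mem_prod, highRange, lowRange, Set.mem_ofPred_eq] at hl
  omega

/-- A distance `C` between scales that absorbs, in both directions, the bounded factors by which the
supports of the wavelets and of the resolution exceed exact dyadic boxes. -/
theorem exists_separation (hα : IsAdmissible α) : ∃ C : ℕ, ∀ i, 2 * α i + 5 ≤ C * α i := by
  have key : ∀ i, ∀ᶠ C : ℕ in Filter.atTop, 2 * α i + 5 ≤ C * α i := fun i =>
    (tendsto_natCast_atTop_atTop.atTop_mul_const (hα.pos i)).eventually_ge_atTop _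
  exact (Filter.eventually_all.2 key).exists

variable {φ₀ : 𝓢(Plane, ℝ)}

theorem rpow_two_lt {a b : ℝ} : (2 : ℝ) ^ a < (2 : ℝ) ^ b ↔ a < b :=
  Real.rpow_lt_rpow_left_iff one_lt_two

/-- A wavelet whose spectrum meets the support of `φⱼ` has its index in `Γₖ(α)` for some `k` close
to `j`. -/
theorem exists_near (hα : IsAdmissible α) (hφ₀ : IsAnisoCutoff α φ₀) (m : MeyerProfile) {C : ℕ}
    (hC : ∀ i, 2 * α i + 5 ≤ C * α i) {l : ℤ × ℤ} (h₁ : -1 ≤ l.1) (h₂ : -1 ≤ l.2) {j : ℕ}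
    {η : Plane} (hj : anisoResolution α φ₀ j ((2 * Real.pi) • η) ≠ 0)
    (hl₁ : m.freq l.1 (-η 0) ≠ 0) (hl₂ : m.freq l.2 (-η 1) ≠ 0) :
    ∃ k ∈ Finset.Icc (j - C) (j + C), l ∈ Gam α k := by
  obtain ⟨s1, s2⟩ := anisoResolution_support hα hφ₀ hj
  obtain ⟨a1, a2⟩ := m.freq_support h₁ hl₁
  obtain ⟨b1, b2⟩ := m.freq_support h₂ hl₂
  rw [mul_neg, abs_neg] at a1 a2 b1 b2
  have e : ∀ i, ((2 * Real.pi) • η) i = 2 * Real.pi * η i := fun i => rfl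
  simp only [e, Fin.forall_fin_two, Fin.exists_fin_two] at s1 s2
  obtain ⟨k, hk, ⟨hk₁, hk₂⟩, hmin⟩ := exists_mem_Gam hα h₁ h₂
  refine ⟨k, ?_, hk⟩
  have p0 := hα.pos 0
  have p1 := hα.pos 1
  have hup : ∀ (a : ℝ) (_ : 0 < a) (z : ℤ), (z ≠ -1 → (z : ℝ) + 1 < (j + 1) * a) →
      z ≤ ⌊((j + 1 : ℕ) : ℝ) * a⌋ + 1 := by
    intro a ha z hz
    by_cases hz1 : z = -1
    · have : 0 ≤ ⌊((j + 1 : ℕ) : ℝ) * a⌋ := Int.floor_nonneg.2 (by positivity)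
      omega
    · have : z ≤ ⌊((j + 1 : ℕ) : ℝ) * a⌋ := Int.le_floor.2 (by
        have := hz hz1
        push_cast; linarith)
      omega
  have hle : k ≤ j + 1 := hmin (j + 1)
    (hup _ p0 _ fun hz => rpow_two_lt.1 ((a2 hz).trans s1.1))
    (hup _ p1 _ fun hz => rpow_two_lt.1 ((b2 hz).trans s1.2))
  have hC1 : 1 ≤ C := by
    by_contra hc
    have : C = 0 := by omega
    have := hC 0
    subst C
    push_cast at this
    linarith
  have hge : j ≤ k + C := by
    by_cases h0 : j = 0
    · omega
    have hlow : ∀ (i : Fin 2) (z : ℤ), ((j : ℝ) - 1) * α i < z + 4 → z ≤ ⌊k * α i⌋ + 1 →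
        j ≤ k + C := by
      intro i z hz hz'
      have h3 : (z : ℝ) ≤ k * α i + 1 := by
        have h4 : (z : ℝ) ≤ (⌊k * α i⌋ : ℝ) + 1 := by exact_mod_cast hz'
        linarith [Int.floor_le ((k : ℝ) * α i)]
      have h5 : (j : ℝ) * α i < (k + C) * α i := by linarith [hC i, hα.pos i]
      have h6 : (j : ℝ) < k + C := lt_of_mul_lt_mul_right h5 (hα.pos i).le
      exact_mod_cast h6.le
    rcases s2 h0 with h | h
    · exact hlow 0 l.1 (rpow_two_lt.1 (h.trans a1)) hk₁
    · exact hlow 1 l.2 (rpow_two_lt.1 (h.trans b1)) hk₂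
  rw [Finset.mem_Icc]
  omega

/-- On the spectrum of a wavelet with index in `Γⱼ(α)`, the functions `φₖ` with `k` close to `j`
add up to `1`. -/
theorem sum_near_eq_one (hα : IsAdmissible α) (hφ₀ : IsAnisoCutoff α φ₀) (m : MeyerProfile) {C : ℕ}
    (hC : ∀ i, 2 * α i + 5 ≤ C * α i) {l : ℤ × ℤ} {j : ℕ} (hl : l ∈ Gam α j) {η : Plane}
    (hl₁ : m.freq l.1 (-η 0) ≠ 0) (hl₂ : m.freq l.2 (-η 1) ≠ 0) :
    ∑ k ∈ Finset.Icc (j - C) (j + C), anisoResolution α φ₀ k ((2 * Real.pi) • η) = 1 := by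
  obtain ⟨⟨h₁, h₂⟩, ⟨u₁, u₂⟩, hlow⟩ := le_of_mem_Gam hα hl
  obtain ⟨a1, a2⟩ := m.freq_support h₁ hl₁
  obtain ⟨b1, b2⟩ := m.freq_support h₂ hl₂
  rw [mul_neg, abs_neg] at a1 a2 b1 b2
  have e : ∀ i, ((2 * Real.pi) • η) i = 2 * Real.pi * η i := fun i => rfl
  have hup : ∀ (i : Fin 2) (z : ℤ), z ≤ ⌊j * α i⌋ + 1 → ∀ x : ℝ, x < (2 : ℝ) ^ ((z : ℝ) + 4) →
      x ≤ (2 : ℝ) ^ (((j + C : ℕ) : ℝ) * α i) := by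
    intro i z hz x hx
    refine hx.le.trans (Real.rpow_le_rpow_of_exponent_le one_le_two ?_)
    have h4 : (z : ℝ) ≤ (⌊j * α i⌋ : ℝ) + 1 := by exact_mod_cast hz
    push_cast
    linarith [Int.floor_le ((j : ℝ) * α i), hC i, hα.pos i]
  have hone : ∑ k ∈ Finset.range (j + C + 1), anisoResolution α φ₀ k ((2 * Real.pi) • η) = 1 := by
    rw [sum_anisoResolution]
    refine boxCutoff_eq_one hφ₀ ?_
    simp only [e, Fin.forall_fin_two]
    exact ⟨hup 0 _ u₁ _ a1, hup 1 _ u₂ _ b1⟩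
  rw [← hone]
  refine Finset.sum_subset (fun k hk => ?_) fun k hk hk' => ?_
  · rw [Finset.mem_Icc] at hk
    rw [Finset.mem_range]
    omega
  by_contra hne
  have hkj : k + C + 1 ≤ j := by
    rw [Finset.mem_range] at hk
    rw [Finset.mem_Icc] at hk'
    omega
  have hkj' : (k : ℝ) + C + 1 ≤ j := by exact_mod_cast hkj
  obtain ⟨s1, -⟩ := anisoResolution_support hα hφ₀ hne
  simp only [e, Fin.forall_fin_two] at s1
  have hcon : ∀ (i : Fin 2) (z : ℤ), ⌊((j : ℝ) - 1) * α i⌋ - 1 ≤ z →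
      (z ≠ -1 → (z : ℝ) + 1 < (k + 1) * α i) → False := by
    intro i z hz hz'
    have hp := hα.pos i
    have h3 : ((j : ℝ) - 1) * α i - 2 < z := by
      have h4 : (⌊((j : ℝ) - 1) * α i⌋ : ℝ) - 1 ≤ z := by exact_mod_cast hz
      linarith [Int.lt_floor_add_one (((j : ℝ) - 1) * α i)]
    have h5 : ((k : ℝ) + C + 1) * α i ≤ j * α i := mul_le_mul_of_nonneg_right hkj' hp.le
    have h6 : 0 ≤ (k : ℝ) * α i := by positivity
    have h7 := hC i
    by_cases h0 : z = -1
    · subst h0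
      push_cast at h3
      nlinarith
    · have := hz' h0
      nlinarith
  rcases hlow with h | h
  · exact hcon 0 _ h fun hz => rpow_two_lt.1 ((a2 hz).trans s1.1)
  · exact hcon 1 _ h fun hz => rpow_two_lt.1 ((b2 hz).trans s1.2)

end Indices

/-! ### Comparison of Littlewood-Paley blocks and wavelet levels -/

theorem ennreal_sq_tsum_mul_le {ι : Type*} (f g : ι → ℝ≥0∞) :
    (∑' i, f i * g i) ^ 2 ≤ (∑' i, f i ^ 2) * ∑' i, g i ^ 2 := by
  have h : ∑' i, f i * g i ≤ ((∑' i, f i ^ 2) * ∑' i, g i ^ 2) ^ (1 / 2 : ℝ) := by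
    rw [ENNReal.tsum_eq_iSup_sum]
    refine iSup_le fun s => ?_
    have := ENNReal.inner_le_Lp_mul_Lq s f g Real.HolderConjugate.two_two
    refine this.trans ?_
    rw [ENNReal.mul_rpow_of_nonneg _ _ (by norm_num)]
    simp only [ENNReal.rpow_ofNat]
    gcongr <;> exact ENNReal.sum_le_tsum s
  calc _ ≤ (((∑' i, f i ^ 2) * ∑' i, g i ^ 2) ^ (1 / 2 : ℝ)) ^ 2 := by gcongr
    _ = _ := by rw [← ENNReal.rpow_natCast, ← ENNReal.rpow_mul]; norm_num

/-- The square of the `ℓ²` norm of the normalized wavelet coefficients of index `l`. -/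
def levelEnergy (m : MeyerProfile) (f : 𝓢'(Plane, ℂ)) (l : ℤ × ℤ) : ℝ≥0∞ :=
  ∑' k : ℤ × ℤ, ‖f (unitWavelet m l k)‖ₑ ^ 2

theorem enorm_sq_eq_ofReal (z : ℂ) : ‖z‖ₑ ^ 2 = ENNReal.ofReal (‖z‖ ^ 2) := by
  rw [ENNReal.ofReal_pow (norm_nonneg _), ofReal_norm]

/-- The action of a distribution on a band-limited function is controlled by the wavelet levels
that the function involves. -/
theorem enorm_apply_sq_le (m : MeyerProfile) (f : 𝓢'(Plane, ℂ)) {J : ℕ} {h : 𝓢(Plane, ℂ)}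
    (hJ : ∀ η : Plane, (∃ i, (2 : ℝ) ^ J / 3 < |η i|) → 𝓕 h η = 0) {A : Finset (ℤ × ℤ)}
    (hA : A ⊆ indexBox J) (hA' : ∀ l ∈ indexBox J, l ∉ A → ∀ k : ℤ × ℤ,
      (inner ℂ ((unitWavelet m l k).toLp 2) (h.toLp 2) : ℂ) = 0) :
    ‖f h‖ₑ ^ 2 ≤ (∑ l ∈ A, levelEnergy m f l) * ENNReal.ofReal (‖h.toLp 2‖ ^ 2) := by
  obtain ⟨-, he⟩ := hasSum_wavelet m hJ f
  obtain ⟨hp, hpe⟩ := parseval_wavelet m hJ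
  set a : ℤ × ℤ → ℤ × ℤ → ℂ := fun l k => inner ℂ ((unitWavelet m l k).toLp 2) (h.toLp 2)
  have h1 : f h = ∑ l ∈ A, ∑' k : ℤ × ℤ, a l k * f (unitWavelet m l k) := by
    rw [he]
    refine (Finset.sum_subset hA fun l hl hl' => ?_).symm
    simp only [hA' l hl hl', zero_mul, tsum_zero]
  have h2 : ‖f h‖ₑ ≤ ∑' p : A × (ℤ × ℤ), ‖f (unitWavelet m p.1 p.2)‖ₑ * ‖a p.1 p.2‖ₑ := by
    rw [h1, ENNReal.tsum_prod', tsum_fintype,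
      Finset.sum_coe_sort A fun l => ∑' k, ‖f (unitWavelet m l k)‖ₑ * ‖a l k‖ₑ]
    refine (enorm_sum_le _ _).trans (Finset.sum_le_sum fun l _ => ?_)
    refine enorm_tsum_le_tsum_enorm.trans_eq (tsum_congr fun k => ?_)
    rw [enorm_mul, mul_comm]
  have h3 : ∑' p : A × (ℤ × ℤ), ‖f (unitWavelet m p.1 p.2)‖ₑ ^ 2 = ∑ l ∈ A, levelEnergy m f l := by
    rw [ENNReal.tsum_prod', tsum_fintype,
      Finset.sum_coe_sort A fun l => ∑' k, ‖f (unitWavelet m l k)‖ₑ ^ 2]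
    rfl
  have h4 : ∑' p : A × (ℤ × ℤ), ‖a p.1 p.2‖ₑ ^ 2 ≤ ENNReal.ofReal (‖h.toLp 2‖ ^ 2) := by
    rw [ENNReal.tsum_prod', tsum_fintype, Finset.sum_coe_sort A fun l => ∑' k, ‖a l k‖ₑ ^ 2,
      ← hpe, ENNReal.ofReal_sum_of_nonneg fun l _ => tsum_nonneg fun k => by positivity]
    refine (Finset.sum_le_sum_of_subset hA).trans (Finset.sum_le_sum fun l hl => ?_)
    rw [ENNReal.ofReal_tsum_of_nonneg (fun k => by positivity) (hp l hl)]
    simp only [enorm_sq_eq_ofReal]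
    exact le_rfl
  calc _ ≤ (∑' p : A × (ℤ × ℤ), ‖f (unitWavelet m p.1 p.2)‖ₑ * ‖a p.1 p.2‖ₑ) ^ 2 := by gcongr
    _ ≤ _ := ennreal_sq_tsum_mul_le _ _
    _ ≤ _ := by rw [h3]; gcongr

/-- Bessel's inequality for a finite set of wavelets. -/
theorem sum_inner_sq_le (m : MeyerProfile) {J : ℕ} {h : 𝓢(Plane, ℂ)}
    (hJ : ∀ η : Plane, (∃ i, (2 : ℝ) ^ J / 3 < |η i|) → 𝓕 h η = 0)
    (P : Finset ((ℤ × ℤ) × (ℤ × ℤ))) (hP : ∀ p ∈ P, p.1 ∈ indexBox J) :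
    ∑ p ∈ P, ‖(inner ℂ ((unitWavelet m p.1 p.2).toLp 2) (h.toLp 2) : ℂ)‖ ^ 2 ≤
      ‖h.toLp 2‖ ^ 2 := by
  classical
  obtain ⟨hp, hpe⟩ := parseval_wavelet m hJ
  have hsub : P ⊆ indexBox J ×ˢ P.image Prod.snd := fun p hp' =>
    Finset.mem_product.2 ⟨hP p hp', Finset.mem_image_of_mem _ hp'⟩
  refine (Finset.sum_le_sum_of_subset_of_nonneg hsub fun _ _ _ => by positivity).trans ?_
  rw [Finset.sum_product, ← hpe]
  exact Finset.sum_le_sum fun l hl => (hp l hl).sum_le_tsum _ fun _ _ => by positivity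

theorem fourier_fourier_apply (w : 𝓢(Plane, ℂ)) (η : Plane) : 𝓕 (𝓕 w) η = w (-η) := by
  have h : 𝓕⁻ (𝓕 w) (-η) = 𝓕 (𝓕 w) η := by
    rw [SchwartzMap.fourierInv_coe, SchwartzMap.fourier_coe (𝓕 w), Real.fourierInv_eq_fourier_neg,
      neg_neg]
  rw [← h, fourierInv_fourier_eq]

theorem freq_ne_zero_of_fourier (m : MeyerProfile) {l : ℤ × ℤ} (k : ℤ × ℤ)
    (h₁ : -1 ≤ l.1) (h₂ : -1 ≤ l.2) {η : Plane} (h : 𝓕 (unitWavelet m l k) η ≠ 0) :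
    m.freq l.1 (η 0) ≠ 0 ∧ m.freq l.2 (η 1) ≠ 0 := by
  rw [unitWavelet, fourier_smul, smul_apply, fourier_hyperbolicWavelet m k h₁ h₂] at h
  constructor <;> intro h0 <;> exact h (by simp [h0])

theorem abs_le_abs_two_pi_mul (t : ℝ) : |t| ≤ |2 * Real.pi * t| := by
  rw [MeyerProfile.abs_two_pi_mul]
  have := Real.pi_gt_three
  nlinarith [abs_nonneg t]

section Blocks

variable {α : Fin 2 → ℝ} {φ₀ : 𝓢(Plane, ℝ)}

/-- The transpose `u ↦ 𝓕 (φⱼ 𝓕⁻¹ u)` of the Littlewood-Paley block on Schwartz functions. -/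
def dualBlock (α : Fin 2 → ℝ) (φ₀ : 𝓢(Plane, ℝ)) (j : ℕ) (u : 𝓢(Plane, ℂ)) : 𝓢(Plane, ℂ) :=
  𝓕 (SchwartzMap.smulLeftCLM ℂ
    (fun η : Plane => ((anisoResolution α φ₀ j ((2 * Real.pi) • η) : ℝ) : ℂ)) (𝓕⁻ u))

theorem anisoBlock_apply (j : ℕ) (f : 𝓢'(Plane, ℂ)) (u : 𝓢(Plane, ℂ)) :
    anisoBlock α φ₀ j f u = f (dualBlock α φ₀ j u) := rfl

theorem fourier_dualBlock (j : ℕ) (u : 𝓢(Plane, ℂ)) (η : Plane) :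
    𝓕 (dualBlock α φ₀ j u) η =
      ((anisoResolution α φ₀ j ((2 * Real.pi) • -η) : ℝ) : ℂ) * 𝓕⁻ u (-η) := by
  rw [dualBlock, fourier_fourier_apply,
    SchwartzMap.smulLeftCLM_apply_apply (hasTemperateGrowth_anisoResolution α φ₀ j), smul_eq_mul]

theorem norm_dualBlock_le {M : ℝ} (hM : ∀ j ξ, |anisoResolution α φ₀ j ξ| ≤ M) (j : ℕ)
    (u : 𝓢(Plane, ℂ)) : ‖(dualBlock α φ₀ j u).toLp 2‖ ≤ M * ‖u.toLp 2‖ := by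
  have e : ‖u.toLp 2‖ = ‖(𝓕⁻ u).toLp 2‖ := by
    rw [← SchwartzMap.norm_fourier_toL2_eq (𝓕⁻ u), fourier_fourierInv_eq]
  rw [dualBlock, SchwartzMap.norm_fourier_toL2_eq, e]
  refine Lp.norm_le_mul_norm_of_ae_le_mul ?_
  filter_upwards [SchwartzMap.coeFn_toLp (𝓕⁻ u) 2 volume, SchwartzMap.coeFn_toLp
    (SchwartzMap.smulLeftCLM ℂ (fun η : Plane =>
      ((anisoResolution α φ₀ j ((2 * Real.pi) • η) : ℝ) : ℂ)) (𝓕⁻ u)) 2 volume] with x h1 h2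
  rw [h1, h2, SchwartzMap.smulLeftCLM_apply_apply (hasTemperateGrowth_anisoResolution α φ₀ j),
    norm_smul, Complex.norm_real]
  exact mul_le_mul_of_nonneg_right (hM _ _) (norm_nonneg _)

theorem anisoResolution_ne_zero_of_fourier {j : ℕ} {u : 𝓢(Plane, ℂ)} {η : Plane}
    (h : 𝓕 (dualBlock α φ₀ j u) η ≠ 0) : anisoResolution α φ₀ j ((2 * Real.pi) • -η) ≠ 0 := by
  intro h0
  rw [fourier_dualBlock, h0] at h
  simp at h

theorem exists_near_of_inner_ne_zero (hα : IsAdmissible α) (hφ₀ : IsAnisoCutoff α φ₀)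
    (m : MeyerProfile) {C : ℕ} (hC : ∀ i, 2 * α i + 5 ≤ C * α i) {l k : ℤ × ℤ} (h₁ : -1 ≤ l.1)
    (h₂ : -1 ≤ l.2) {j : ℕ} {u : 𝓢(Plane, ℂ)}
    (h : (inner ℂ ((unitWavelet m l k).toLp 2) ((dualBlock α φ₀ j u).toLp 2) : ℂ) ≠ 0) :
    ∃ k ∈ Finset.Icc (j - C) (j + C), l ∈ Gam α k := by
  by_contra hcon
  refine h ?_
  rw [← SchwartzMap.inner_fourier_toL2_eq, SchwartzMap.inner_toL2_toL2_eq _ _ volume]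
  refine integral_eq_zero_of_ae (Filter.Eventually.of_forall fun η => ?_)
  by_contra hne
  have hw : 𝓕 (unitWavelet m l k) η ≠ 0 := fun h0 => hne (by simp [h0])
  have hd : 𝓕 (dualBlock α φ₀ j u) η ≠ 0 := fun h0 => hne (by simp [h0])
  obtain ⟨f₁, f₂⟩ := freq_ne_zero_of_fourier m k h₁ h₂ hw
  exact hcon (exists_near hα hφ₀ m hC h₁ h₂ (anisoResolution_ne_zero_of_fourier hd)
    (by simpa using f₁) (by simpa using f₂))

theorem norm_le_of_enorm_sq_le {z : ℂ} {b : ℝ≥0∞} {y : ℝ} (hb : b ≠ ⊤) (hy : 0 ≤ y)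
    (h : ‖z‖ₑ ^ 2 ≤ b * ENNReal.ofReal (y ^ 2)) : ‖z‖ ≤ √b.toReal * y := by
  rw [← ENNReal.ofReal_toReal hb, enorm_sq_eq_ofReal, ← ENNReal.ofReal_mul ENNReal.toReal_nonneg,
    ENNReal.ofReal_le_ofReal_iff (mul_nonneg ENNReal.toReal_nonneg (sq_nonneg y))] at h
  refine (le_abs_self _).trans (abs_le_of_sq_le_sq ?_ (by positivity))
  rwa [mul_pow, Real.sq_sqrt ENNReal.toReal_nonneg]

theorem sum_le_sum_tsum_subtype {ι κ : Type*} {A : Finset ι} {W : Finset κ} (S : κ → Set ι)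
    (F : ι → ℝ≥0∞) (h : ∀ l ∈ A, ∃ k ∈ W, l ∈ S k) :
    ∑ l ∈ A, F l ≤ ∑ k ∈ W, ∑' l : S k, F l := by
  calc ∑ l ∈ A, F l ≤ ∑ l ∈ A, ∑ k ∈ W, (S k).indicator F l := by
        refine Finset.sum_le_sum fun l hl => ?_
        obtain ⟨k, hk, hlk⟩ := h l hl
        rw [← Set.indicator_of_mem hlk F]
        exact Finset.single_le_sum (f := fun k => (S k).indicator F l) (fun _ _ => zero_le) hk
    _ = ∑ k ∈ W, ∑ l ∈ A, (S k).indicator F l := Finset.sum_comm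
    _ ≤ _ := by
        refine Finset.sum_le_sum fun k _ => ?_
        rw [tsum_subtype (S k) F]
        exact ENNReal.sum_le_tsum A

theorem exists_fourier_dualBlock_eq_zero (hα : IsAdmissible α) (hφ₀ : IsAnisoCutoff α φ₀) (j : ℕ) :
    ∃ J : ℕ, ∀ (u : 𝓢(Plane, ℂ)) (η : Plane), (∃ i, (2 : ℝ) ^ J / 3 < |η i|) →
      𝓕 (dualBlock α φ₀ j u) η = 0 := by
  obtain ⟨J, hJb⟩ := pow_unbounded_of_one_lt
    (3 * ((2 : ℝ) ^ (((j : ℝ) + 1) * α 0) + (2 : ℝ) ^ (((j : ℝ) + 1) * α 1))) one_lt_two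
  refine ⟨J, ?_⟩
  rintro u η ⟨i, hi⟩
  by_contra hne
  have h1 := (anisoResolution_support hα hφ₀
    (anisoResolution_ne_zero_of_fourier hne)).1 i
  have e : ((2 * Real.pi) • -η) i = -(2 * Real.pi * η i) := by simp
  rw [e, abs_neg] at h1
  have h2 := abs_le_abs_two_pi_mul (η i)
  have p0 : 0 < (2 : ℝ) ^ (((j : ℝ) + 1) * α 0) := by positivity
  have p1 : 0 < (2 : ℝ) ^ (((j : ℝ) + 1) * α 1) := by positivity
  fin_cases i <;> simp only [Fin.mk_one, Fin.zero_eta] at hi h1 h2 <;> linarith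

theorem enorm_anisoBlock_apply_sq_le (hα : IsAdmissible α) (hφ₀ : IsAnisoCutoff α φ₀)
    (m : MeyerProfile) {C : ℕ} (hC : ∀ i, 2 * α i + 5 ≤ C * α i) (f : 𝓢'(Plane, ℂ)) (j : ℕ)
    (u : 𝓢(Plane, ℂ)) :
    ‖anisoBlock α φ₀ j f u‖ₑ ^ 2 ≤
      (∑ k ∈ Finset.Icc (j - C) (j + C), ∑' l : Gam α k, levelEnergy m f l) *
        ENNReal.ofReal (‖(dualBlock α φ₀ j u).toLp 2‖ ^ 2) := by
  classical
  obtain ⟨J, hJ⟩ := exists_fourier_dualBlock_eq_zero hα hφ₀ j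
  rw [anisoBlock_apply]
  refine (enorm_apply_sq_le m f (hJ u) (A := (indexBox J).filter fun l =>
    ∃ k ∈ Finset.Icc (j - C) (j + C), l ∈ Gam α k) (Finset.filter_subset _ _) ?_).trans
    (mul_le_mul_left (sum_le_sum_tsum_subtype _ _ fun l hl => (Finset.mem_filter.1 hl).2) _)
  intro l hl hlA k
  obtain ⟨h₁, h₂⟩ := neg_one_le_of_mem_indexBox hl
  by_contra hne
  exact hlA (Finset.mem_filter.2 ⟨hl, exists_near_of_inner_ne_zero hα hφ₀ m hC h₁ h₂ hne⟩)

theorem distL2Norm_sq_le {T : 𝓢'(Plane, ℂ)} {b : ℝ≥0∞} (hb : b ≠ ⊤) {M : ℝ} (hM : 0 ≤ M)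
    (h : ∀ u : 𝓢(Plane, ℂ), ‖T u‖ ≤ √b.toReal * (M * ‖u.toLp 2‖)) :
    distL2Norm T ^ 2 ≤ ENNReal.ofReal (M ^ 2) * b := by
  calc _ ≤ ENNReal.ofReal (√b.toReal * M) ^ 2 := by
        gcongr; exact distL2Norm_le_of_bound fun u => (h u).trans_eq (mul_assoc _ _ _).symm
    _ = ENNReal.ofReal (M ^ 2) * b := by
        rw [← ENNReal.ofReal_pow (by positivity), mul_pow, Real.sq_sqrt ENNReal.toReal_nonneg,
          mul_comm, ENNReal.ofReal_mul (by positivity), ENNReal.ofReal_toReal hb]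

/-- A Littlewood-Paley block is controlled by the wavelet levels of neighbouring index sets. -/
theorem distL2Norm_anisoBlock_sq_le (hα : IsAdmissible α) (hφ₀ : IsAnisoCutoff α φ₀)
    (m : MeyerProfile) {C : ℕ} (hC : ∀ i, 2 * α i + 5 ≤ C * α i) {M : ℝ} (hM1 : 1 ≤ M)
    (hM : ∀ j ξ, |anisoResolution α φ₀ j ξ| ≤ M) (f : 𝓢'(Plane, ℂ)) (j : ℕ) :
    distL2Norm (anisoBlock α φ₀ j f) ^ 2 ≤ ENNReal.ofReal (M ^ 2) *
      ∑ k ∈ Finset.Icc (j - C) (j + C), ∑' l : Gam α k, levelEnergy m f l := by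
  have hb := enorm_anisoBlock_apply_sq_le hα hφ₀ m hC f j
  generalize ∑ k ∈ Finset.Icc (j - C) (j + C), ∑' l : Gam α k, levelEnergy m f l = b at hb ⊢
  by_cases hbt : b = ⊤
  · have : ENNReal.ofReal (M ^ 2) ≠ 0 := by
      rw [Ne, ENNReal.ofReal_eq_zero, not_le]; positivity
    rw [hbt, ENNReal.mul_top this]
    exact le_top
  · refine distL2Norm_sq_le hbt (zero_le_one.trans hM1) fun u => ?_
    exact (norm_le_of_enorm_sq_le hbt (norm_nonneg _) (hb u)).trans
      (mul_le_mul_of_nonneg_left (norm_dualBlock_le hM j u) (Real.sqrt_nonneg _))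

theorem fourier_sum_smul_unitWavelet (m : MeyerProfile) (P : Finset ((ℤ × ℤ) × (ℤ × ℤ)))
    (c : (ℤ × ℤ) × (ℤ × ℤ) → ℂ) (η : Plane) :
    𝓕 (∑ p ∈ P, c p • unitWavelet m p.1 p.2) η =
      ∑ p ∈ P, c p * 𝓕 (unitWavelet m p.1 p.2) η := by
  have h := congrArg (fun u : 𝓢(Plane, ℂ) => u η) (map_sum (FourierTransform.fourierCLM ℂ 𝓢(Plane, ℂ))
    (fun p => c p • unitWavelet m p.1 p.2) P)
  simp only [map_smul] at h
  refine h.trans ?_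
  rw [sum_apply]
  rfl

theorem exists_freq_ne_zero_of_fourier_sum (m : MeyerProfile)
    {P : Finset ((ℤ × ℤ) × (ℤ × ℤ))} (hP : ∀ p ∈ P, -1 ≤ p.1.1 ∧ -1 ≤ p.1.2)
    {c : (ℤ × ℤ) × (ℤ × ℤ) → ℂ} {η : Plane}
    (h : 𝓕 (∑ p ∈ P, c p • unitWavelet m p.1 p.2) η ≠ 0) :
    ∃ p ∈ P, m.freq p.1.1 (η 0) ≠ 0 ∧ m.freq p.1.2 (η 1) ≠ 0 := by
  rw [fourier_sum_smul_unitWavelet] at h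
  obtain ⟨p, hp, hne⟩ := Finset.exists_ne_zero_of_sum_ne_zero h
  exact ⟨p, hp, freq_ne_zero_of_fourier m p.2 (hP p hp).1 (hP p hp).2 (right_ne_zero_of_mul hne)⟩

/-- Finite combinations of wavelets are band-limited. -/
theorem exists_bandlimit_sum (m : MeyerProfile) (P : Finset ((ℤ × ℤ) × (ℤ × ℤ)))
    (hP : ∀ p ∈ P, -1 ≤ p.1.1 ∧ -1 ≤ p.1.2) (c : (ℤ × ℤ) × (ℤ × ℤ) → ℂ) :
    ∃ J : ℕ, (∀ η : Plane, (∃ i, (2 : ℝ) ^ J / 3 < |η i|) →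
      𝓕 (∑ p ∈ P, c p • unitWavelet m p.1 p.2) η = 0) ∧ ∀ p ∈ P, p.1 ∈ indexBox J := by
  have hJ : ∃ J : ℕ, ∀ p ∈ P, p.1.1 + 6 ≤ J ∧ p.1.2 + 6 ≤ J := by
    have : ∀ᶠ J : ℕ in Filter.atTop, ∀ p ∈ P, p.1.1 + 6 ≤ J ∧ p.1.2 + 6 ≤ J := by
      rw [Filter.eventually_all_finset]
      intro p _
      filter_upwards [Filter.eventually_ge_atTop (p.1.1 + 6).toNat,
        Filter.eventually_ge_atTop (p.1.2 + 6).toNat] with J h1 h2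
      omega
    exact this.exists
  obtain ⟨J, hJ⟩ := hJ
  have hfreq : ∀ l : ℤ, -1 ≤ l → l + 6 ≤ J → ∀ t : ℝ, m.freq l t ≠ 0 →
      |t| ≤ (2 : ℝ) ^ J / 3 := by
    intro l hl hlJ t ht
    have h1 := (m.freq_support hl ht).1
    have h2 := abs_le_abs_two_pi_mul t
    have h3 : (2 : ℝ) ^ ((l : ℝ) + 4) ≤ (2 : ℝ) ^ ((J : ℝ) - 2) :=
      Real.rpow_le_rpow_of_exponent_le one_le_two (by
        have : (l : ℝ) + 6 ≤ J := by exact_mod_cast hlJ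
        linarith)
    rw [Real.rpow_sub two_pos, Real.rpow_natCast] at h3
    have : (0 : ℝ) < 2 ^ J := by positivity
    norm_num at h3
    linarith
  refine ⟨J, ?_, fun p hp => ?_⟩
  · rintro η ⟨i, hi⟩
    by_contra hne
    obtain ⟨p, hp, h1, h2⟩ := exists_freq_ne_zero_of_fourier_sum m hP hne
    have g1 := hfreq _ (hP p hp).1 (hJ p hp).1 _ h1
    have g2 := hfreq _ (hP p hp).2 (hJ p hp).2 _ h2
    fin_cases i <;> simp only [Fin.mk_one, Fin.zero_eta] at hi <;> linarith
  · have := hP p hp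
    have := hJ p hp
    simp only [indexBox, Finset.mem_product, Finset.mem_Ico]
    omega

theorem le_of_sq_le_mul {x y w z : ℝ} (hx : 0 ≤ x) (hy : 0 ≤ y) (h1 : x ≤ w) (h2 : w ^ 2 ≤ y * z)
    (h3 : z ≤ x) : x ≤ y := by
  rcases hx.eq_or_lt with rfl | hx
  · exact hy
  · have : x * x ≤ y * x := by nlinarith [mul_le_mul_of_nonneg_left h3 hy]
    exact le_of_mul_le_mul_right this hx

/-- Bessel's inequality in dual form: finite combinations of the normalized wavelets have `L²` norm
at most the `ℓ²` norm of their coefficients. -/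
theorem norm_sum_smul_unitWavelet_sq_le (m : MeyerProfile) (P : Finset ((ℤ × ℤ) × (ℤ × ℤ)))
    (hP : ∀ p ∈ P, -1 ≤ p.1.1 ∧ -1 ≤ p.1.2) (c : (ℤ × ℤ) × (ℤ × ℤ) → ℂ) :
    ‖(∑ p ∈ P, c p • unitWavelet m p.1 p.2).toLp 2‖ ^ 2 ≤ ∑ p ∈ P, ‖c p‖ ^ 2 := by
  obtain ⟨J, hJ, hPJ⟩ := exists_bandlimit_sum m P hP c
  have hb := sum_inner_sq_le m hJ P hPJ
  set g := ∑ p ∈ P, c p • unitWavelet m p.1 p.2 with hg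
  have e : ((‖g.toLp 2‖ ^ 2 : ℝ) : ℂ) =
      ∑ p ∈ P, (starRingEnd ℂ) (c p) * inner ℂ ((unitWavelet m p.1 p.2).toLp 2) (g.toLp 2) := by
    have : g.toLp 2 volume = ∑ p ∈ P, c p • (unitWavelet m p.1 p.2).toLp 2 volume := by
      have := map_sum (SchwartzMap.toLpCLM ℂ ℂ 2 (volume : Measure Plane))
        (fun p => c p • unitWavelet m p.1 p.2) P
      simp only [map_smul] at this
      exact this
    have hn := inner_self_eq_norm_sq_to_K (𝕜 := ℂ) (g.toLp 2 volume)
    have hs := congrArg (fun v => (inner ℂ v (g.toLp 2 volume) : ℂ)) this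
    simp only [sum_inner, inner_smul_left] at hs
    rw [Complex.ofReal_pow]
    exact hn.symm.trans hs
  have h1 : ‖g.toLp 2‖ ^ 2 ≤ ∑ p ∈ P, ‖c p‖ *
      ‖(inner ℂ ((unitWavelet m p.1 p.2).toLp 2) (g.toLp 2) : ℂ)‖ := by
    have h := norm_sum_le P fun p =>
      (starRingEnd ℂ) (c p) * (inner ℂ ((unitWavelet m p.1 p.2).toLp 2) (g.toLp 2) : ℂ)
    rw [← e, Complex.norm_real, Real.norm_of_nonneg (sq_nonneg _)] at h
    simpa only [norm_mul, RCLike.norm_conj] using h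
  have h2 := Finset.sum_mul_sq_le_sq_mul_sq P (fun p => ‖c p‖)
    (fun p => ‖(inner ℂ ((unitWavelet m p.1 p.2).toLp 2) (g.toLp 2) : ℂ)‖)
  exact le_of_sq_le_mul (sq_nonneg _) (Finset.sum_nonneg fun _ _ => sq_nonneg _) h1 h2 hb

/-- The blocks close to `j` reproduce the combinations of wavelets with indices in `Γⱼ(α)`. -/
theorem sum_dualBlock_eq (hα : IsAdmissible α) (hφ₀ : IsAnisoCutoff α φ₀)
    (m : MeyerProfile) {C : ℕ} (hC : ∀ i, 2 * α i + 5 ≤ C * α i) {j : ℕ}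
    {P : Finset ((ℤ × ℤ) × (ℤ × ℤ))} (hP : ∀ p ∈ P, p.1 ∈ Gam α j)
    (c : (ℤ × ℤ) × (ℤ × ℤ) → ℂ) :
    ∑ k ∈ Finset.Icc (j - C) (j + C),
      dualBlock α φ₀ k (∑ p ∈ P, c p • unitWavelet m p.1 p.2) =
        ∑ p ∈ P, c p • unitWavelet m p.1 p.2 := by
  have hP' : ∀ p ∈ P, -1 ≤ p.1.1 ∧ -1 ≤ p.1.2 := fun p hp => (le_of_mem_Gam hα (hP p hp)).1
  have hne := fun η => exists_freq_ne_zero_of_fourier_sum m hP' (c := c) (η := η)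
  generalize ∑ p ∈ P, c p • unitWavelet m p.1 p.2 = g at hne ⊢
  have hsum : ∑ k ∈ Finset.Icc (j - C) (j + C), SchwartzMap.smulLeftCLM ℂ
      (fun η : Plane => ((anisoResolution α φ₀ k ((2 * Real.pi) • η) : ℝ) : ℂ)) (𝓕⁻ g) = 𝓕⁻ g := by
    ext η
    rw [sum_apply]
    simp only [SchwartzMap.smulLeftCLM_apply_apply (hasTemperateGrowth_anisoResolution α φ₀ _),
      smul_eq_mul]
    rw [← Finset.sum_mul, ← Complex.ofReal_sum]
    by_cases h0 : 𝓕⁻ g η = 0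
    · rw [h0, mul_zero]
    · have e : 𝓕 g (-η) = 𝓕⁻ g η := by
        rw [SchwartzMap.fourierInv_coe, SchwartzMap.fourier_coe, Real.fourierInv_eq_fourier_neg]
      obtain ⟨p, hp, h1, h2⟩ := hne (-η) (by rwa [e])
      rw [sum_near_eq_one hα hφ₀ m hC (hP p hp) (by simpa using h1) (by simpa using h2)]
      simp
  have h := congrArg (FourierTransform.fourierCLM ℂ 𝓢(Plane, ℂ)) hsum
  rw [map_sum, FourierTransform.fourierCLM_apply, fourier_fourierInv_eq] at h
  exact h

/-- A finite part of the energy of `Γⱼ(α)`, by duality: it is the value of `f` at the combination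
of wavelets with the conjugate coefficients. -/
theorem sum_sq_apply_unitWavelet_le (hα : IsAdmissible α) (hφ₀ : IsAnisoCutoff α φ₀)
    (m : MeyerProfile) {C : ℕ} (hC : ∀ i, 2 * α i + 5 ≤ C * α i) (f : 𝓢'(Plane, ℂ)) (j : ℕ)
    (hD : ∀ k ∈ Finset.Icc (j - C) (j + C), distL2Norm (anisoBlock α φ₀ k f) ≠ ⊤)
    {P : Finset ((ℤ × ℤ) × (ℤ × ℤ))} (hP : ∀ p ∈ P, p.1 ∈ Gam α j) :
    ∑ p ∈ P, ‖f (unitWavelet m p.1 p.2)‖ ^ 2 ≤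
      (∑ k ∈ Finset.Icc (j - C) (j + C), (distL2Norm (anisoBlock α φ₀ k f)).toReal) ^ 2 := by
  have hP' : ∀ p ∈ P, -1 ≤ p.1.1 ∧ -1 ≤ p.1.2 := fun p hp => (le_of_mem_Gam hα (hP p hp)).1
  have h1 := norm_sum_smul_unitWavelet_sq_le m P hP'
    fun p => (starRingEnd ℂ) (f (unitWavelet m p.1 p.2))
  have h2 := sum_dualBlock_eq hα hφ₀ m hC hP
    fun p => (starRingEnd ℂ) (f (unitWavelet m p.1 p.2))
  have h3 : f (∑ p ∈ P, (starRingEnd ℂ) (f (unitWavelet m p.1 p.2)) • unitWavelet m p.1 p.2) =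
      ((∑ p ∈ P, ‖f (unitWavelet m p.1 p.2)‖ ^ 2 : ℝ) : ℂ) := by
    rw [map_sum, Complex.ofReal_sum]
    refine Finset.sum_congr rfl fun p _ => ?_
    rw [map_smul, smul_eq_mul, mul_comm, Complex.mul_conj, Complex.normSq_eq_norm_sq]
  simp only [RCLike.norm_conj] at h1
  have hX : 0 ≤ ∑ p ∈ P, ‖f (unitWavelet m p.1 p.2)‖ ^ 2 := Finset.sum_nonneg fun _ _ => sq_nonneg _
  generalize ∑ p ∈ P, (starRingEnd ℂ) (f (unitWavelet m p.1 p.2)) • unitWavelet m p.1 p.2 = g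
    at h1 h2 h3
  generalize ∑ p ∈ P, ‖f (unitWavelet m p.1 p.2)‖ ^ 2 = X at h1 h3 hX ⊢
  have h4 : X ≤ (∑ k ∈ Finset.Icc (j - C) (j + C),
      (distL2Norm (anisoBlock α φ₀ k f)).toReal) * ‖g.toLp 2‖ := by
    have h5 : ‖f g‖ ≤ ∑ k ∈ Finset.Icc (j - C) (j + C), ‖anisoBlock α φ₀ k f g‖ := by
      simp only [anisoBlock_apply]
      conv_lhs => rw [← h2, map_sum]
      exact norm_sum_le _ _
    rw [h3, Complex.norm_real, Real.norm_of_nonneg hX] at h5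
    refine h5.trans ?_
    rw [Finset.sum_mul]
    exact Finset.sum_le_sum fun k hk => norm_apply_le_distL2Norm (hD k hk) g
  refine le_of_sq_le_mul hX (sq_nonneg _) h4 (mul_pow _ _ 2).le h1

/-- The wavelet levels of an index set are controlled by the neighbouring Littlewood-Paley
blocks. -/
theorem tsum_levelEnergy_le (hα : IsAdmissible α) (hφ₀ : IsAnisoCutoff α φ₀)
    (m : MeyerProfile) {C : ℕ} (hC : ∀ i, 2 * α i + 5 ≤ C * α i) (f : 𝓢'(Plane, ℂ)) (j : ℕ) :
    ∑' l : Gam α j, levelEnergy m f l ≤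
      (∑ k ∈ Finset.Icc (j - C) (j + C), distL2Norm (anisoBlock α φ₀ k f)) ^ 2 := by
  by_cases hD : ∀ k ∈ Finset.Icc (j - C) (j + C), distL2Norm (anisoBlock α φ₀ k f) ≠ ⊤
  · have e : ∑' l : Gam α j, levelEnergy m f l =
        ∑' p : Gam α j × (ℤ × ℤ), ‖f (unitWavelet m p.1 p.2)‖ₑ ^ 2 := by
      rw [ENNReal.tsum_prod']
      rfl
    rw [e, ENNReal.tsum_eq_iSup_sum]
    refine iSup_le fun s => ?_
    have h := sum_sq_apply_unitWavelet_le hα hφ₀ m hC f j hD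
      (P := s.map ((Function.Embedding.subtype (Gam α j)).prodMap (Function.Embedding.refl _)))
      (by
        intro p hp
        obtain ⟨q, -, rfl⟩ := Finset.mem_map.1 hp
        exact q.1.2)
    rw [Finset.sum_map] at h
    simp only [enorm_sq_eq_ofReal]
    rw [← ENNReal.ofReal_sum_of_nonneg fun _ _ => sq_nonneg _]
    refine (ENNReal.ofReal_le_ofReal h).trans_eq ?_
    rw [ENNReal.ofReal_pow (Finset.sum_nonneg fun _ _ => ENNReal.toReal_nonneg),
      ENNReal.ofReal_sum_of_nonneg fun _ _ => ENNReal.toReal_nonneg]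
    congr 1
    exact Finset.sum_congr rfl fun k hk => ENNReal.ofReal_toReal (hD k hk)
  · push Not at hD
    obtain ⟨k, hk, hkt⟩ := hD
    rw [ENNReal.sum_eq_top.2 ⟨k, hk, hkt⟩]
    simp

end Blocks

/-! ### Weighted sums over scales -/

theorem rpow_scale_le (s : ℝ) {C j k : ℕ} (h : k ∈ Finset.Icc (j - C) (j + C)) :
    (2 : ℝ) ^ (2 * j * s) ≤ (2 : ℝ) ^ (2 * C * |s|) * (2 : ℝ) ^ (2 * k * s) := by
  rw [← Real.rpow_add two_pos]
  refine Real.rpow_le_rpow_of_exponent_le one_le_two ?_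
  obtain ⟨h1, h2⟩ := Finset.mem_Icc.1 h
  have h1' : (j : ℝ) - C ≤ k := by
    have : j ≤ k + C := by omega
    have : (j : ℝ) ≤ k + C := by exact_mod_cast this
    linarith
  have h2' : (k : ℝ) ≤ j + C := by exact_mod_cast h2
  have h3 : ((j : ℝ) - k) * s ≤ C * |s| := by
    refine (le_abs_self _).trans ?_
    rw [abs_mul]
    gcongr
    exact abs_le.2 ⟨by linarith, by linarith⟩
  linarith

theorem tsum_sum_Icc_le (C : ℕ) (c : ℕ → ℝ≥0∞) :
    ∑' j : ℕ, ∑ k ∈ Finset.Icc (j - C) (j + C), c k ≤ (2 * C + 1 : ℕ) * ∑' k, c k := by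
  have h : ∀ j k : ℕ, (↑(Finset.Icc (j - C) (j + C)) : Set ℕ).indicator c k =
      (↑(Finset.Icc (k - C) (k + C)) : Set ℕ).indicator (fun _ => c k) j := by
    intro j k
    by_cases hk : k ∈ Finset.Icc (j - C) (j + C)
    · have hj : j ∈ Finset.Icc (k - C) (k + C) := by
        rw [Finset.mem_Icc] at hk ⊢; omega
      rw [Set.indicator_of_mem (Finset.mem_coe.2 hk), Set.indicator_of_mem (Finset.mem_coe.2 hj)]
    · have hj : j ∉ Finset.Icc (k - C) (k + C) := by
        rw [Finset.mem_Icc] at hk ⊢; omega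
      rw [Set.indicator_of_notMem (mt Finset.mem_coe.1 hk),
        Set.indicator_of_notMem (mt Finset.mem_coe.1 hj)]
  rw [tsum_congr fun j => (sum_eq_tsum_indicator c (Finset.Icc (j - C) (j + C))).trans
    (tsum_congr (h j)), ENNReal.tsum_comm, ← ENNReal.tsum_mul_left]
  refine ENNReal.tsum_le_tsum fun k => ?_
  rw [← sum_eq_tsum_indicator, Finset.sum_const, nsmul_eq_mul, Nat.card_Icc]
  gcongr
  omega

/-- Weighted summability over scales passes to a sequence that is controlled by sums over
neighbouring scales. -/
theorem tsum_rpow_mul_lt_top {a b : ℕ → ℝ≥0∞} {C : ℕ} {K : ℝ≥0∞} (hK : K ≠ ⊤) (s : ℝ)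
    (h : ∀ j, a j ≤ K * ∑ k ∈ Finset.Icc (j - C) (j + C), b k)
    (hb : ∑' j : ℕ, ENNReal.ofReal ((2 : ℝ) ^ (2 * j * s)) * b j < ⊤) :
    ∑' j : ℕ, ENNReal.ofReal ((2 : ℝ) ^ (2 * j * s)) * a j < ⊤ := by
  set K' := ENNReal.ofReal ((2 : ℝ) ^ (2 * C * |s|))
  have h1 : ∀ j : ℕ, ENNReal.ofReal ((2 : ℝ) ^ (2 * j * s)) * a j ≤ (K' * K) *
      ∑ k ∈ Finset.Icc (j - C) (j + C), ENNReal.ofReal ((2 : ℝ) ^ (2 * k * s)) * b k := by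
    intro j
    calc _ ≤ ENNReal.ofReal ((2 : ℝ) ^ (2 * j * s)) *
          (K * ∑ k ∈ Finset.Icc (j - C) (j + C), b k) := by gcongr; exact h j
      _ = K * ∑ k ∈ Finset.Icc (j - C) (j + C), ENNReal.ofReal ((2 : ℝ) ^ (2 * j * s)) * b k := by
          rw [← Finset.mul_sum]; ring
      _ ≤ K * ∑ k ∈ Finset.Icc (j - C) (j + C),
          K' * (ENNReal.ofReal ((2 : ℝ) ^ (2 * k * s)) * b k) := by
          refine mul_le_mul_right (Finset.sum_le_sum fun k hk => ?_) K
          rw [← mul_assoc, ← ENNReal.ofReal_mul (by positivity)]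
          exact mul_le_mul_left (ENNReal.ofReal_le_ofReal (rpow_scale_le s hk)) _
      _ = _ := by rw [← Finset.mul_sum]; ring
  refine (ENNReal.tsum_le_tsum h1).trans_lt ?_
  rw [ENNReal.tsum_mul_left]
  refine ENNReal.mul_lt_top (ENNReal.mul_lt_top ENNReal.ofReal_lt_top hK.lt_top) ?_
  exact (tsum_sum_Icc_le C _).trans_lt (ENNReal.mul_lt_top (ENNReal.natCast_lt_top _) hb)

theorem sq_sum_le_card_mul (W : Finset ℕ) (D : ℕ → ℝ≥0∞) :
    (∑ k ∈ W, D k) ^ 2 ≤ W.card * ∑ k ∈ W, D k ^ 2 := by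
  have h := ENNReal.rpow_sum_le_const_mul_sum_rpow W D (p := 2) (by norm_num)
  norm_num at h
  exact h

/-! ### Normalization of the wavelet coefficients -/

theorem scale_bounds {l : ℤ} (hl : -1 ≤ l) : (2 : ℝ) ^ l ≤ scale l ∧ scale l ≤ 2 * (2 : ℝ) ^ l := by
  rw [scale, ← zpow_one_add₀ two_ne_zero]
  constructor <;> exact zpow_le_zpow_right₀ one_le_two (by omega)

theorem coeffL2Norm_sq (m : MeyerProfile) (f : 𝓢'(Plane, ℂ)) (l : ℤ × ℤ) :
    coeffL2Norm m f l ^ 2 = ENNReal.ofReal (scale l.1 * scale l.2) * levelEnergy m f l := by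
  rw [coeffL2Norm, ← ENNReal.rpow_natCast, ← ENNReal.rpow_mul]
  norm_num
  rw [levelEnergy, ← ENNReal.tsum_mul_left]
  refine tsum_congr fun k => ?_
  have h1 : ‖waveletCoeff m f l k‖ = scale l.1 * scale l.2 * ‖f (hyperbolicWavelet m l k)‖ := by
    rw [waveletCoeff, norm_mul, norm_zpow, Complex.norm_ofNat, zpow_add₀ two_ne_zero]
    rfl
  have h2 : ‖f (unitWavelet m l k)‖ ^ 2 =
      scale l.1 * scale l.2 * ‖f (hyperbolicWavelet m l k)‖ ^ 2 := by
    rw [unitWavelet, map_smul, norm_smul, Complex.norm_real,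
      Real.norm_of_nonneg (Real.sqrt_nonneg _), mul_pow, Real.sq_sqrt (scale_mul_pos l).le]
  rw [enorm_sq_eq_ofReal, enorm_sq_eq_ofReal, ← ENNReal.ofReal_mul (scale_mul_pos l).le, h1, h2]
  congr 1
  ring

/-- The factor `2 ^ (-(l₁ + l₂))` undoes the normalization of the coefficients, except that each
index `-1` costs a factor `2`. -/
theorem coeff_term_bounds (m : MeyerProfile) (f : 𝓢'(Plane, ℂ)) {l : ℤ × ℤ} (h₁ : -1 ≤ l.1)
    (h₂ : -1 ≤ l.2) :
    levelEnergy m f l ≤ ENNReal.ofReal ((2 : ℝ) ^ (-(l.1 + l.2))) * coeffL2Norm m f l ^ 2 ∧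
      ENNReal.ofReal ((2 : ℝ) ^ (-(l.1 + l.2))) * coeffL2Norm m f l ^ 2 ≤
        4 * levelEnergy m f l := by
  obtain ⟨a1, a2⟩ := scale_bounds h₁
  obtain ⟨b1, b2⟩ := scale_bounds h₂
  have p1 : (0 : ℝ) < 2 ^ l.1 := by positivity
  have p2 : (0 : ℝ) < 2 ^ l.2 := by positivity
  have e : (2 : ℝ) ^ (-(l.1 + l.2)) * (scale l.1 * scale l.2) =
      (scale l.1 / 2 ^ l.1) * (scale l.2 / 2 ^ l.2) := by
    rw [zpow_neg, zpow_add₀ two_ne_zero]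
    field_simp
  have c1 : 1 ≤ scale l.1 / 2 ^ l.1 := (one_le_div p1).2 a1
  have c2 : scale l.1 / 2 ^ l.1 ≤ 2 := (div_le_iff₀ p1).2 a2
  have d1 : 1 ≤ scale l.2 / 2 ^ l.2 := (one_le_div p2).2 b1
  have d2 : scale l.2 / 2 ^ l.2 ≤ 2 := (div_le_iff₀ p2).2 b2
  rw [coeffL2Norm_sq, ← mul_assoc, ← ENNReal.ofReal_mul (by positivity), e]
  constructor
  · refine le_mul_of_one_le_left zero_le ?_
    rw [ENNReal.one_le_ofReal]
    nlinarith
  · gcongr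
    rw [show (4 : ℝ≥0∞) = ENNReal.ofReal 4 by simp]
    exact ENNReal.ofReal_le_ofReal (by nlinarith)

theorem rpow_half_lt_top_iff {x : ℝ≥0∞} : x ^ (1 / 2 : ℝ) < ⊤ ↔ x < ⊤ :=
  ENNReal.rpow_lt_top_iff_of_pos (by norm_num)

end HyperbolicWavelet

end

theorem mainTheorem3 (α : Fin 2 → ℝ) (hα : HyperbolicWavelet.IsAdmissible α) (s : ℝ)
    (φ₀ : 𝓢(HyperbolicWavelet.Plane, ℝ)) (hφ₀ : HyperbolicWavelet.IsAnisoCutoff α φ₀)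
    (m : HyperbolicWavelet.MeyerProfile) (f : 𝓢'(HyperbolicWavelet.Plane, ℂ)) :
    f ∈ HyperbolicWavelet.anisoSobolev α φ₀ s ↔
      (∑' j : ℕ, ENNReal.ofReal ((2 : ℝ) ^ (2 * j * s)) *
        ∑' l : HyperbolicWavelet.Gam α j,
          ENNReal.ofReal ((2 : ℝ) ^ (-(l.1.1 + l.1.2))) *
            HyperbolicWavelet.coeffL2Norm m f l.1 ^ 2) ^ (1 / 2 : ℝ) < ⊤ := by
  open HyperbolicWavelet in
  obtain ⟨M, hM1, hM⟩ := exists_abs_anisoResolution_le hφ₀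
  obtain ⟨C, hC⟩ := exists_separation hα
  have hl : ∀ j (l : Gam α j), -1 ≤ l.1.1 ∧ -1 ≤ l.1.2 := fun j l => (le_of_mem_Gam hα l.2).1
  change anisoSobolevNorm α φ₀ s f < ⊤ ↔ _
  rw [anisoSobolevNorm, rpow_half_lt_top_iff, rpow_half_lt_top_iff]
  constructor
  · refine tsum_rpow_mul_lt_top (C := C) (K := 4 * (2 * C + 1 : ℕ))
      (ENNReal.mul_ne_top (by simp) (ENNReal.natCast_ne_top _)) s fun j => ?_
    calc _ ≤ ∑' l : Gam α j, 4 * levelEnergy m f l :=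
          ENNReal.tsum_le_tsum fun l => (coeff_term_bounds m f (hl j l).1 (hl j l).2).2
      _ = 4 * ∑' l : Gam α j, levelEnergy m f l := ENNReal.tsum_mul_left
      _ ≤ 4 * (∑ k ∈ Finset.Icc (j - C) (j + C), distL2Norm (anisoBlock α φ₀ k f)) ^ 2 := by
          gcongr; exact tsum_levelEnergy_le hα hφ₀ m hC f j
      _ ≤ 4 * ((Finset.Icc (j - C) (j + C)).card *
            ∑ k ∈ Finset.Icc (j - C) (j + C), distL2Norm (anisoBlock α φ₀ k f) ^ 2) := by
          gcongr; exact sq_sum_le_card_mul _ _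
      _ ≤ _ := by
          rw [mul_assoc, Nat.card_Icc]
          gcongr
          omega
  · refine tsum_rpow_mul_lt_top (C := C) (K := ENNReal.ofReal (M ^ 2)) ENNReal.ofReal_ne_top s
      fun j => (distL2Norm_anisoBlock_sq_le hα hφ₀ m hC hM1 hM f j).trans ?_
    gcongr with k _ l
    exact (coeff_term_bounds m f (hl k l).1 (hl k l).2).1
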